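/- \textbf{Conventions.} A CDGA is a commutative differential graded algebra over $\mathbb{Q}$, graded in degrees $\ge 0$, with differential of degree $+1$; it is simply-connected if $H^0=\mathbb{Q}$ and $H^1=0$. A CDGA map is $n$-connected if it induces isomorphisms on $H^i$ for $i<n$ and an injection on $H^n$. A Hirsch extension $\mathcal{M}\subseteq\mathcal{M}\langle V\rangle$ of degree $k$ along a vector space $V$ is a pushout of $\Lambda S^{k+1}(V)\to\Lambda D^{k+1}(V)$: one freely adjoins $V$ as generators of degree $k$ with prescribed differentials $d:V\to\mathcal{M}^{k+1}$ (cocycles). A $k$-minimal algebra is a CDGA $\mathcal{M}$ with a filtration $\mathbb{Q}=\mathcal{M}_0\subseteq\dots\subseteq\mathcal{M}_k=\mathcal{M}$ in which $\mathcal{M}_{j-1}\subseteq\mathcal{M}_j$ is a Hirsch extension of degree $j$; a $k$-minimal model of $\mathcal{A}$ is a $(k+1)$-connected map $\mathcal{M}\to\mathcal{A}$ from a $k$-minimal algebra. A homotopy from $p$ to $q$, for CDGA maps $p,q:\mathcal{M}\to\mathcal{B}$, is a CDGA map $H:\mathcal{M}\to\mathcal{B}\otimes\Lambda(t,dt)$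 restricting to $p$ at $t=0$ and to $q$ at $t=1$; $\int_0^tH$ and $\int_0^1H$ denote its composites with the fibre integrals $b\otimes\omega\mapsto(-1)^{|b|}b\otimes\int_0^t\omega$ and $b\otimes\omega\mapsto(-1)^{|b|}(\int_0^1\omega)\,b$. A $k$-minimal model of a CDGA map $f:\mathcal{A}\to\mathcal{B}$ consists of $k$-minimal models $m:\mathcal{M}\to\mathcal{A}$, $n:\mathcal{N}\to\mathcal{B}$, a map $g:\mathcal{M}\to\mathcal{N}$ and a homotopy $H$ from $fm$ to $ng$. The cone of $m$ is the cochain complex $C_m^i=\mathcal{M}^{i+1}\oplus\mathcal{A}^i$ with $d(a,b)=(da,\,m(a)-db)$, and such a model induces the cochain map $\varphi:C_m\to C_n$, $\varphi(a,b)=(g(a),\,f(b)+\int_0^1H(a))$. For $k\ge1$, $Q^k(\mathcal{M})$ is the degree $k$ part of $\overline{\mathcal{M}}/(\overline{\mathcal{M}}\cdot\overline{\mathcal{M}})$, where $\overline{\mathcal{M}}=\bigoplus_{i>0}\mathcal{M}^i$. \textbf{Lemma.} Let $f:\mathcal{A}\to\mathcal{B}$ be a map of simply-connected CDGAs, let $k\ge2$,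 and let $(g:\mathcal{M}\to\mathcal{N},\,m,\,n,\,H)$ be a $(k-1)$-minimal model of $f$, with induced cochain map $\varphi:C_m\to C_n$. Put $V=H^kC_m$, $W=H^kC_n$ and $\psi=H^k\varphi:V\to W$. Then there exist Hirsch extensions $\mathcal{M}\subseteq\mathcal{M}\langle V\rangle$ and $\mathcal{N}\subseteq\mathcal{N}\langle W\rangle$ of degree $k$ and a $k$-minimal model $(\overline g:\mathcal{M}\langle V\rangle\to\mathcal{N}\langle W\rangle,\,\overline m,\,\overline n,\,\overline H)$ of $f$ such that $\overline g,\overline m,\overline n,\overline H$ extend $g,m,n,H$ and: \begin{enumerate} \item for every $\alpha\in V$ the pair $(d\alpha,\overline m(\alpha))$ is a cocycle of $C_m$ representing $\alpha$, and for every $\beta\in W$ the pair $(d\beta,\overline n(\beta))$ is a cocycle of $C_n$ representing $\beta$; \item the canonical maps $V\to Q^k(\mathcal{M}\langle V\rangle)$ and $W\to Q^k(\mathcal{N}\langle W\rangle)$ are isomorphisms, and under these identifications $Q^k(\overline g)=H^k\varphi$; \item there is a complement $U$ of $\ker\psi$ in $V$ such that for every $\varepsilon\in U$ $$(d\psi(\varepsilon),\overline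 n(\psi(\varepsilon)))=\varphi(d\varepsilon,\overline m(\varepsilon)),\qquad \overline g(\varepsilon)=\psi(\varepsilon),\qquad \overline H(\varepsilon)=f(\overline m(\varepsilon))\otimes1+\int_0^tH(d\varepsilon),$$ and for every $\alpha\in\ker\psi$ there are $x\in\mathcal{N}^k$ and $y\in\mathcal{B}^{k-1}$ with $d(x,y)=\varphi(d\alpha,\overline m(\alpha))$ in $C_n$ and $$\overline g(\alpha)=x,\qquad \overline H(\alpha)=f(\overline m(\alpha))\otimes1+\int_0^tH(d\alpha)+d(y\otimes t).$$ \end{enumerate} -/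

import Mathlib

open scoped TensorProduct DirectSum Polynomial

universe u v w

/-- A commutative differential graded algebra over `ℚ`, graded in degrees `n ≥ 0`, with
differential of degree `+1`. -/
structure CDGA : Type (u + 1) where
  carrier : Type u
  [ring : Ring carrier]
  [algebra : Algebra ℚ carrier]
  /-- the homogeneous elements of degree `n` -/
  deg : ℕ → Submodule ℚ carrier
  [graded : GradedAlgebra deg]
  d : carrier →ₗ[ℚ] carrier
  d_mem : ∀ {n : ℕ} {a : carrier}, a ∈ deg n → d a ∈ deg (n + 1)
  d_d : ∀ a : carrier, d (d a) = 0
  leibniz : ∀ {n : ℕ} {a : carrier}, a ∈ deg n → ∀ b : carrier,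
    d (a * b) = d a * b + (-1 : ℚ) ^ n • (a * d b)
  graded_comm : ∀ {i j : ℕ} {a b : carrier}, a ∈ deg i → b ∈ deg j →
    a * b = (-1 : ℚ) ^ (i * j) • (b * a)

namespace CDGA

attribute [instance] CDGA.ring CDGA.algebra CDGA.graded

/-- A map of CDGAs: a morphism of algebras that preserves degrees and commutes with `d`. -/
structure Hom (A : CDGA.{u}) (B : CDGA.{v}) where
  toAlgHom : A.carrier →ₐ[ℚ] B.carrier
  map_deg : ∀ {n : ℕ} {a : A.carrier}, a ∈ A.deg n → toAlgHom a ∈ B.deg n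
  map_d : ∀ a : A.carrier, toAlgHom (A.d a) = B.d (toAlgHom a)

namespace Hom

instance (A : CDGA.{u}) (B : CDGA.{v}) : CoeFun (Hom A B) fun _ => A.carrier → B.carrier :=
  ⟨fun f => f.toAlgHom⟩

def comp {A : CDGA.{u}} {B : CDGA.{v}} {C : CDGA.{w}} (g : Hom B C) (f : Hom A B) : Hom A C where
  toAlgHom := g.toAlgHom.comp f.toAlgHom
  map_deg h := g.map_deg (f.map_deg h)
  map_d a := by simp [f.map_d, g.map_d]

end Hom

/-! ### Gradings from projections, and the sign involution -/

theorem isInternal_of_proj {E : Type u} [AddCommGroup E] [Module ℚ E] (D : ℕ → Submodule ℚ E)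
    (π : ℕ → E →ₗ[ℚ] E) (h_top : ∀ x, x ∈ ⨆ n, D n)
    (h_same : ∀ n, ∀ x ∈ D n, π n x = x) (h_ne : ∀ m n, m ≠ n → ∀ x ∈ D m, π n x = 0) :
    DirectSum.IsInternal D := by
  refine (DirectSum.isInternal_submodule_iff_iSupIndep_and_iSup_eq_top D).2 ⟨?_, ?_⟩
  · intro n
    rw [Submodule.disjoint_def]
    intro x hx hx'
    have hle : (⨆ (j) (_ : j ≠ n), D j) ≤ LinearMap.ker (π n) :=
      iSup₂_le fun j hj y hy => h_ne j n hj y hy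
    rw [← h_same n x hx]
    exact hle hx'
  · exact eq_top_iff.2 fun x _ => h_top x

/-- The involution `a ↦ (-1)^n a` for `a` of degree `n`. -/
noncomputable def sign (A : CDGA.{u}) : A.carrier →ₗ[ℚ] A.carrier :=
  (DirectSum.toModule ℚ ℕ A.carrier fun n => (-1 : ℚ) ^ n • (A.deg n).subtype) ∘ₗ
    (DirectSum.decomposeLinearEquiv A.deg).toLinearMap

theorem sign_of_mem (A : CDGA.{u}) {n : ℕ} {a : A.carrier} (h : a ∈ A.deg n) :
    A.sign a = (-1 : ℚ) ^ n • a := by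
  lift a to A.deg n using h
  simp only [sign, LinearMap.comp_apply, LinearEquiv.coe_coe, DirectSum.decomposeLinearEquiv_apply,
    DirectSum.decompose_coe]
  rw [← DirectSum.lof_eq_of ℚ, DirectSum.toModule_lof]
  rfl

/-- The projection onto the degree `n` part. -/
def proj (A : CDGA.{u}) (n : ℕ) : A.carrier →ₗ[ℚ] A.carrier :=
  (A.deg n).subtype ∘ₗ (DirectSum.component ℚ ℕ (fun i => A.deg i) n) ∘ₗ
    (DirectSum.decomposeLinearEquiv A.deg).toLinearMap

theorem proj_same (A : CDGA.{u}) {n : ℕ} {a : A.carrier} (h : a ∈ A.deg n) : A.proj n a = a :=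
  DirectSum.decompose_of_mem_same A.deg h

theorem proj_ne (A : CDGA.{u}) {m n : ℕ} (hmn : m ≠ n) {a : A.carrier} (h : a ∈ A.deg m) :
    A.proj n a = 0 :=
  DirectSum.decompose_of_mem_ne A.deg h hmn

theorem induction_homogeneous (A : CDGA.{u}) {P : A.carrier → Prop} (h0 : P 0)
    (hadd : ∀ a b, P a → P b → P (a + b)) (hdeg : ∀ n, ∀ a ∈ A.deg n, P a) (a : A.carrier) : P a :=
  DirectSum.Decomposition.inductionOn A.deg h0 (fun m => hdeg _ _ m.2) hadd a

theorem linearMap_ext_homogeneous (A : CDGA.{u}) {E : Type v} [AddCommGroup E] [Module ℚ E]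
    {f g : A.carrier →ₗ[ℚ] E} (h : ∀ n, ∀ a ∈ A.deg n, f a = g a) : f = g := by
  ext a
  refine A.induction_homogeneous (P := fun a => f a = g a) (by simp) ?_ h a
  intro a b ha hb
  simp [ha, hb]

theorem sign_d (A : CDGA.{u}) (a : A.carrier) : A.sign (A.d a) = -A.d (A.sign a) := by
  refine LinearMap.congr_fun (f := A.sign ∘ₗ A.d) (g := -(A.d ∘ₗ A.sign))
    (A.linearMap_ext_homogeneous fun n a ha => ?_) a
  simp [A.sign_of_mem ha, A.sign_of_mem (A.d_mem ha), pow_succ]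

theorem sign_sign (A : CDGA.{u}) (a : A.carrier) : A.sign (A.sign a) = a := by
  refine LinearMap.congr_fun (f := A.sign ∘ₗ A.sign) (g := LinearMap.id)
    (A.linearMap_ext_homogeneous fun n a ha => ?_) a
  simp [A.sign_of_mem ha, smul_smul, ← mul_pow]

/-! ### Tensor products -/

section Tensor

open GradedTensorProduct

variable (A : CDGA.{u}) (B : CDGA.{v})

/-- The tensor product of the underlying algebras, with the usual sign
`(a ⊗ b) (a' ⊗ b') = (-1)^(|b| |a'|) a a' ⊗ b b'`. -/
abbrev TensorCarrier : Type (max u v) := A.deg ᵍ⊗[ℚ] B.deg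

/-- Degree `n` part of the tensor product: the span of `a ⊗ b` with `|a| + |b| = n`. -/
noncomputable def tensorDeg (n : ℕ) : Submodule ℚ (TensorCarrier A B) :=
  Submodule.span ℚ {x | ∃ i j : ℕ, i + j = n ∧ ∃ a ∈ A.deg i, ∃ b ∈ B.deg j, x = a ᵍ⊗ₜ[ℚ] b}

/-- `d (a ⊗ b) = d a ⊗ b + (-1)^|a| a ⊗ d b`. -/
noncomputable def tensorD : TensorCarrier A B →ₗ[ℚ] TensorCarrier A B :=
  (of ℚ A.deg B.deg).toLinearMap ∘ₗ
    (TensorProduct.map A.d LinearMap.id + TensorProduct.map A.sign B.d) ∘ₗ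
    (of ℚ A.deg B.deg).symm.toLinearMap

theorem tensorD_tmul (a : A.carrier) (b : B.carrier) :
    tensorD A B (a ᵍ⊗ₜ[ℚ] b) = A.d a ᵍ⊗ₜ[ℚ] b + A.sign a ᵍ⊗ₜ[ℚ] B.d b := by
  simp [tensorD, tmul]

theorem tmul_mem_tensorDeg {i j : ℕ} {a : A.carrier} {b : B.carrier} (ha : a ∈ A.deg i)
    (hb : b ∈ B.deg j) : (a ᵍ⊗ₜ[ℚ] b : TensorCarrier A B) ∈ tensorDeg A B (i + j) :=
  Submodule.subset_span ⟨i, j, rfl, a, ha, b, hb, rfl⟩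

theorem tmul_mul_tmul {j i : ℕ} (a : A.carrier) {b : B.carrier} (hb : b ∈ B.deg j)
    {a' : A.carrier} (ha' : a' ∈ A.deg i) (b' : B.carrier) :
    (a ᵍ⊗ₜ[ℚ] b * a' ᵍ⊗ₜ[ℚ] b' : TensorCarrier A B) =
      (-1 : ℚ) ^ (j * i) • ((a * a') ᵍ⊗ₜ[ℚ] (b * b')) := by
  have h := tmul_coe_mul_coe_tmul (R := ℚ) A.deg B.deg a ⟨b, hb⟩ ⟨a', ha'⟩ b'
  rw [h, Units.smul_def, ← Int.cast_smul_eq_zsmul ℚ]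
  congr 1
  have e := uzpow_natCast (R := ℕ) (-1) (j * i)
  rw [Nat.cast_id] at e
  rw [e]
  simp

theorem tensor_mem_iSup (x : TensorCarrier A B) : x ∈ ⨆ n, tensorDeg A B n := by
  refine TensorProduct.induction_on (motive := fun y : A.carrier ⊗[ℚ] B.carrier =>
    (of ℚ A.deg B.deg y) ∈ ⨆ n, tensorDeg A B n) ((of ℚ A.deg B.deg).symm x) ?_ ?_ ?_
  · simp
  · intro a b
    refine A.induction_homogeneous (P := fun a => of ℚ A.deg B.deg (a ⊗ₜ b) ∈ _) ?_ ?_ ?_ a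
    · simp
    · intro a a' h h'
      rw [TensorProduct.add_tmul, map_add]
      exact add_mem h h'
    · intro i a ha
      refine B.induction_homogeneous (P := fun b => of ℚ A.deg B.deg (a ⊗ₜ b) ∈ _) ?_ ?_ ?_ b
      · simp
      · intro b b' h h'
        rw [TensorProduct.tmul_add, map_add]
        exact add_mem h h'
      · intro j b hb
        exact Submodule.mem_iSup_of_mem (i + j) (tmul_mem_tensorDeg A B ha hb)
  · intro x y hx hy
    rw [map_add]
    exact add_mem hx hy

/-- A property that is additive holds on the tensor product if it holds on `a ⊗ b` for
homogeneous `a`, `b`. -/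
theorem tensor_induction {P : TensorCarrier A B → Prop} (h0 : P 0)
    (hadd : ∀ x y, P x → P y → P (x + y)) (hsmul : ∀ (r : ℚ) x, P x → P (r • x))
    (h : ∀ i j, ∀ a ∈ A.deg i, ∀ b ∈ B.deg j, P (a ᵍ⊗ₜ[ℚ] b)) (x : TensorCarrier A B) : P x := by
  refine Submodule.iSup_induction (tensorDeg A B) (motive := P) (tensor_mem_iSup A B x) ?_ h0 hadd
  intro n y hy
  refine Submodule.span_induction (p := fun y _ => P y) ?_ h0 (fun x y _ _ => hadd x y)
    (fun r x _ => hsmul r x) hy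
  rintro _ ⟨i, j, -, a, ha, b, hb, rfl⟩
  exact h i j a ha b hb

theorem tensorDeg_induction {n : ℕ} {P : TensorCarrier A B → Prop} (h0 : P 0)
    (hadd : ∀ x y, P x → P y → P (x + y)) (hsmul : ∀ (r : ℚ) x, P x → P (r • x))
    (h : ∀ i j, i + j = n → ∀ a ∈ A.deg i, ∀ b ∈ B.deg j, P (a ᵍ⊗ₜ[ℚ] b))
    {x : TensorCarrier A B} (hx : x ∈ tensorDeg A B n) : P x := by
  refine Submodule.span_induction (p := fun y _ => P y) ?_ h0 (fun x y _ _ => hadd x y)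
    (fun r x _ => hsmul r x) hx
  rintro _ ⟨i, j, hij, a, ha, b, hb, rfl⟩
  exact h i j hij a ha b hb

/-- The projection onto the degree `n` part of the tensor product. -/
noncomputable def tensorProj (n : ℕ) : TensorCarrier A B →ₗ[ℚ] TensorCarrier A B :=
  (of ℚ A.deg B.deg).toLinearMap ∘ₗ
    (∑ p ∈ Finset.HasAntidiagonal.antidiagonal n, TensorProduct.map (A.proj p.1) (B.proj p.2)) ∘ₗ
    (of ℚ A.deg B.deg).symm.toLinearMap

theorem tensorProj_tmul (n : ℕ) (a : A.carrier) (b : B.carrier) :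
    tensorProj A B n (a ᵍ⊗ₜ[ℚ] b) =
      ∑ p ∈ Finset.HasAntidiagonal.antidiagonal n, A.proj p.1 a ᵍ⊗ₜ[ℚ] B.proj p.2 b := by
  simp [tensorProj, tmul]

theorem tensor_isInternal : DirectSum.IsInternal (tensorDeg A B) := by
  refine isInternal_of_proj _ (tensorProj A B) (tensor_mem_iSup A B) ?_ ?_
  · intro n x hx
    refine tensorDeg_induction A B (P := fun x => tensorProj A B n x = x) (by simp)
      (fun x y hx hy => by rw [map_add, hx, hy]) (fun r x hx => by rw [map_smul, hx]) ?_ hx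
    intro i j hij a ha b hb
    rw [tensorProj_tmul, Finset.sum_eq_single (i, j)]
    · rw [A.proj_same ha, B.proj_same hb]
    · rintro ⟨i', j'⟩ h hne
      by_cases hi : i = i'
      · subst hi
        have : j = j' := by have := Finset.HasAntidiagonal.mem_antidiagonal.1 h; simp at this; omega
        exact absurd (by rw [this]) hne
      · simp [A.proj_ne hi ha]
    · intro h
      exact absurd (Finset.HasAntidiagonal.mem_antidiagonal.2 hij) h
  · intro m n hmn x hx
    refine tensorDeg_induction A B (P := fun x => tensorProj A B n x = 0) (by simp)
      (fun x y hx hy => by rw [map_add, hx, hy, add_zero])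
      (fun r x hx => by rw [map_smul, hx, smul_zero]) ?_ hx
    intro i j hij a ha b hb
    rw [tensorProj_tmul]
    refine Finset.sum_eq_zero ?_
    rintro ⟨i', j'⟩ h
    by_cases hi : i = i'
    · have : j ≠ j' := by have := Finset.HasAntidiagonal.mem_antidiagonal.1 h; simp at this; omega
      simp [B.proj_ne this hb]
    · simp [A.proj_ne hi ha]

theorem tensor_mul_mem {m n : ℕ} {x y : TensorCarrier A B} (hx : x ∈ tensorDeg A B m)
    (hy : y ∈ tensorDeg A B n) : x * y ∈ tensorDeg A B (m + n) := by
  refine tensorDeg_induction A B (P := fun x => x * y ∈ tensorDeg A B (m + n)) (by simp)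
    (fun x x' hx hx' => by rw [add_mul]; exact add_mem hx hx')
    (fun r x hx => by rw [smul_mul_assoc]; exact Submodule.smul_mem _ _ hx) ?_ hx
  intro i j hij a ha b hb
  refine tensorDeg_induction A B (P := fun y => a ᵍ⊗ₜ[ℚ] b * y ∈ tensorDeg A B (m + n)) (by simp)
    (fun x x' hx hx' => by rw [mul_add]; exact add_mem hx hx')
    (fun r x hx => by rw [mul_smul_comm]; exact Submodule.smul_mem _ _ hx) ?_ hy
  intro i' j' hij' a' ha' b' hb'
  rw [tmul_mul_tmul A B a hb ha' b']
  refine Submodule.smul_mem _ _ ?_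
  have h := tmul_mem_tensorDeg A B (SetLike.mul_mem_graded ha ha') (SetLike.mul_mem_graded hb hb')
  have e : i + i' + (j + j') = m + n := by omega
  rwa [e] at h

theorem tensor_one_mem : (1 : TensorCarrier A B) ∈ tensorDeg A B 0 := by
  have h : (1 : TensorCarrier A B) = (1 : A.carrier) ᵍ⊗ₜ[ℚ] (1 : B.carrier) := by
    rw [← of_one, Algebra.TensorProduct.one_def]
  exact Submodule.subset_span ⟨0, 0, rfl, 1, SetLike.one_mem_graded A.deg, 1,
    SetLike.one_mem_graded B.deg, h⟩

noncomputable instance tensorGraded : GradedAlgebra (tensorDeg A B) where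
  one_mem := tensor_one_mem A B
  mul_mem _ _ _ _ hx hy := tensor_mul_mem A B hx hy
  toDecomposition := (tensor_isInternal A B).chooseDecomposition

theorem tensorD_mem {n : ℕ} {x : TensorCarrier A B} (hx : x ∈ tensorDeg A B n) :
    tensorD A B x ∈ tensorDeg A B (n + 1) := by
  refine tensorDeg_induction A B (P := fun x => tensorD A B x ∈ tensorDeg A B (n + 1)) (by simp)
    (fun x y hx hy => by rw [map_add]; exact add_mem hx hy)
    (fun r x hx => by rw [map_smul]; exact Submodule.smul_mem _ _ hx) ?_ hx
  intro i j hij a ha b hb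
  rw [tensorD_tmul, A.sign_of_mem ha]
  refine add_mem ?_ ?_
  · have h := tmul_mem_tensorDeg A B (A.d_mem ha) hb
    have e : i + 1 + j = n + 1 := by omega
    rwa [e] at h
  · have h := tmul_mem_tensorDeg A B (Submodule.smul_mem _ ((-1 : ℚ) ^ i) ha) (B.d_mem hb)
    have e : i + (j + 1) = n + 1 := by omega
    rwa [e] at h

theorem tensorD_tensorD (x : TensorCarrier A B) : tensorD A B (tensorD A B x) = 0 := by
  refine tensor_induction A B (P := fun x => tensorD A B (tensorD A B x) = 0) (by simp)
    (fun x y hx hy => by rw [map_add, map_add, hx, hy, add_zero])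
    (fun r x hx => by rw [map_smul, map_smul, hx, smul_zero]) ?_ x
  intro i j a ha b hb
  rw [tensorD_tmul, map_add, tensorD_tmul, tensorD_tmul, A.d_d, B.d_d, A.sign_d]
  simp [tmul, TensorProduct.neg_tmul]

theorem tensor_leibniz {n : ℕ} {x : TensorCarrier A B} (hx : x ∈ tensorDeg A B n)
    (y : TensorCarrier A B) :
    tensorD A B (x * y) = tensorD A B x * y + (-1 : ℚ) ^ n • (x * tensorD A B y) := by
  refine tensorDeg_induction A B (P := fun x => tensorD A B (x * y) =
      tensorD A B x * y + (-1 : ℚ) ^ n • (x * tensorD A B y)) (by simp)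
    (fun x y hx hy => by simp only [add_mul, map_add, hx, hy, smul_add]; abel)
    (fun r x hx => by
      simp only [smul_mul_assoc, map_smul, hx, smul_add]
      rw [smul_comm r]) ?_ hx
  intro i j hij a ha b hb
  refine tensor_induction A B (P := fun y => tensorD A B (a ᵍ⊗ₜ[ℚ] b * y) =
      tensorD A B (a ᵍ⊗ₜ[ℚ] b) * y + (-1 : ℚ) ^ n • (a ᵍ⊗ₜ[ℚ] b * tensorD A B y)) (by simp)
    (fun x y hx hy => by simp only [mul_add, map_add, hx, hy, smul_add]; abel)
    (fun r x hx => by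
      simp only [mul_smul_comm, map_smul, hx, smul_add]
      rw [smul_comm r]) ?_ y
  intro i' j' a' ha' b' hb'
  subst hij
  rw [tmul_mul_tmul A B a hb ha' b', map_smul, tensorD_tmul, tensorD_tmul, tensorD_tmul,
    A.sign_of_mem ha, A.sign_of_mem ha', A.sign_of_mem (SetLike.mul_mem_graded ha ha'), add_mul,
    mul_add, tmul_mul_tmul A B _ hb ha', tmul_mul_tmul A B _ (B.d_mem hb) ha',
    tmul_mul_tmul A B _ hb (A.d_mem ha'),
    tmul_mul_tmul A B _ hb (Submodule.smul_mem _ _ ha'), A.leibniz ha, B.leibniz hb]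
  simp only [tmul, TensorProduct.add_tmul, TensorProduct.tmul_add, map_add, map_smul,
    ← TensorProduct.smul_tmul', TensorProduct.tmul_smul, smul_add, smul_smul, smul_mul_assoc,
    mul_smul_comm]
  have e : ∀ m : ℕ, (-1 : ℚ) ^ (m + m) = 1 := fun m => by rw [← two_mul]; simp
  have s1 : (-1 : ℚ) ^ (i + j) * (-1) ^ (j * (i' + 1)) = (-1 : ℚ) ^ (j * i') * (-1) ^ i := by
    rw [← pow_add, ← pow_add, show i + j + j * (i' + 1) = (j * i' + i) + (j + j) by ring,
      pow_add _ _ (j + j), e, mul_one]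
  rw [s1]
  module

theorem tensor_comm {m n : ℕ} {x y : TensorCarrier A B} (hx : x ∈ tensorDeg A B m)
    (hy : y ∈ tensorDeg A B n) : x * y = (-1 : ℚ) ^ (m * n) • (y * x) := by
  refine tensorDeg_induction A B (P := fun x => x * y = (-1 : ℚ) ^ (m * n) • (y * x)) (by simp)
    (fun x x' hx hx' => by rw [add_mul, mul_add, hx, hx', smul_add])
    (fun r x hx => by rw [smul_mul_assoc, mul_smul_comm, hx, smul_comm]) ?_ hx
  intro i j hij a ha b hb
  refine tensorDeg_induction A B
    (P := fun y => a ᵍ⊗ₜ[ℚ] b * y = (-1 : ℚ) ^ (m * n) • (y * a ᵍ⊗ₜ[ℚ] b)) (by simp)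
    (fun x x' hx hx' => by rw [add_mul, mul_add, hx, hx', smul_add])
    (fun r x hx => by rw [smul_mul_assoc, mul_smul_comm, hx, smul_comm]) ?_ hy
  intro i' j' hij' a' ha' b' hb'
  subst hij hij'
  rw [tmul_mul_tmul A B a hb ha' b', tmul_mul_tmul A B a' hb' ha b, A.graded_comm ha ha',
    B.graded_comm hb hb']
  simp only [tmul, ← TensorProduct.smul_tmul', TensorProduct.tmul_smul, map_smul, smul_smul,
    ← pow_add]
  congr 1
  have : (i + j) * (i' + j') + j' * i = (j * i' + i * i' + j * j') + (j' * i + j' * i) := by ring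
  rw [this, pow_add _ _ (j' * i + j' * i), ← two_mul (j' * i)]
  simp [add_assoc, add_comm (i * i')]

/-- The tensor product `A ⊗ B` of CDGAs. -/
noncomputable def tensor : CDGA.{max u v} where
  carrier := TensorCarrier A B
  deg := tensorDeg A B
  d := tensorD A B
  d_mem := tensorD_mem A B
  d_d := tensorD_tensorD A B
  leibniz := tensor_leibniz A B
  graded_comm := tensor_comm A B

end Tensor

/-! ### Polynomial forms on the interval -/

section Interval

open TrivSqZeroExt

/-- The underlying algebra of `Λ(t, dt)`: the dual numbers `ℚ[t] ⊕ ℚ[t] dt` with `dt * dt = 0`.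
The element `p + q dt` is `inl p + inr q`. -/
abbrev IntervalCarrier : Type := DualNumber ℚ[X]

/-- `p + q dt ↦ p`. -/
noncomputable def fnPart : IntervalCarrier →ₗ[ℚ] ℚ[X] := (fstHom ℚ ℚ[X] ℚ[X]).toLinearMap

/-- `p + q dt ↦ q`. -/
noncomputable def formPart : IntervalCarrier →ₗ[ℚ] ℚ[X] :=
  (sndHom ℚ[X] ℚ[X]).restrictScalars ℚ

/-- `p ↦ p`. -/
noncomputable def ofFn : ℚ[X] →ₗ[ℚ] IntervalCarrier := (inlAlgHom ℚ ℚ[X] ℚ[X]).toLinearMap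

/-- `q ↦ q dt`. -/
noncomputable def ofForm : ℚ[X] →ₗ[ℚ] IntervalCarrier :=
  (inrHom ℚ[X] ℚ[X]).restrictScalars ℚ

theorem fnPart_apply (x : IntervalCarrier) : fnPart x = x.fst := rfl
theorem formPart_apply (x : IntervalCarrier) : formPart x = x.snd := rfl
theorem ofFn_apply (p : ℚ[X]) : ofFn p = inl p := rfl
theorem ofForm_apply (q : ℚ[X]) : ofForm q = inr q := rfl

/-- `ℚ[t]` in degree `0`, `ℚ[t] dt` in degree `1`, and `0` in higher degrees. -/
noncomputable def intervalDeg : ℕ → Submodule ℚ IntervalCarrier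
  | 0 => LinearMap.range ofFn
  | 1 => LinearMap.range ofForm
  | _ + 2 => ⊥

/-- The projections of `Λ(t, dt)` onto its homogeneous parts. -/
noncomputable def intervalProj : ℕ → IntervalCarrier →ₗ[ℚ] IntervalCarrier
  | 0 => ofFn ∘ₗ fnPart
  | 1 => ofForm ∘ₗ formPart
  | _ + 2 => 0

theorem mem_intervalDeg_cases {n : ℕ} {x : IntervalCarrier} (hx : x ∈ intervalDeg n) :
    (n = 0 ∧ ∃ p, x = inl p) ∨ (n = 1 ∧ ∃ q, x = inr q) ∨ x = 0 := by
  rcases n with _ | _ | n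
  · obtain ⟨p, rfl⟩ := hx
    exact Or.inl ⟨rfl, p, rfl⟩
  · obtain ⟨q, rfl⟩ := hx
    exact Or.inr (Or.inl ⟨rfl, q, rfl⟩)
  · exact Or.inr (Or.inr ((Submodule.mem_bot ℚ).1 hx))

theorem inl_mem_intervalDeg (p : ℚ[X]) : (inl p : IntervalCarrier) ∈ intervalDeg 0 := ⟨p, rfl⟩

theorem inr_mem_intervalDeg (q : ℚ[X]) : (inr q : IntervalCarrier) ∈ intervalDeg 1 := ⟨q, rfl⟩

theorem interval_isInternal : DirectSum.IsInternal intervalDeg := by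
  refine isInternal_of_proj _ intervalProj ?_ ?_ ?_
  · intro x
    rw [← inl_fst_add_inr_snd_eq x]
    exact add_mem (Submodule.mem_iSup_of_mem 0 (inl_mem_intervalDeg _))
      (Submodule.mem_iSup_of_mem 1 (inr_mem_intervalDeg _))
  · intro n x hx
    rcases mem_intervalDeg_cases hx with ⟨rfl, p, rfl⟩ | ⟨rfl, q, rfl⟩ | rfl
    · simp [intervalProj, ofFn_apply, fnPart_apply]
    · simp [intervalProj, ofForm_apply, formPart_apply]
    · simp
  · intro m n hmn x hx
    rcases mem_intervalDeg_cases hx with ⟨rfl, p, rfl⟩ | ⟨rfl, q, rfl⟩ | rfl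
    · rcases n with _ | _ | n
      · exact absurd rfl hmn
      · simp [intervalProj, ofForm_apply, formPart_apply]
      · rfl
    · rcases n with _ | _ | n
      · simp [intervalProj, ofFn_apply, fnPart_apply]
      · exact absurd rfl hmn
      · rfl
    · simp

theorem interval_mul_mem {m n : ℕ} {x y : IntervalCarrier} (hx : x ∈ intervalDeg m)
    (hy : y ∈ intervalDeg n) : x * y ∈ intervalDeg (m + n) := by
  rcases mem_intervalDeg_cases hx with ⟨rfl, p, rfl⟩ | ⟨rfl, q, rfl⟩ | rfl
  · rcases mem_intervalDeg_cases hy with ⟨rfl, p', rfl⟩ | ⟨rfl, q', rfl⟩ | rfl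
    · rw [← inl_mul]
      exact inl_mem_intervalDeg _
    · rw [inl_mul_inr]
      exact inr_mem_intervalDeg _
    · rw [mul_zero]
      exact zero_mem _
  · rcases mem_intervalDeg_cases hy with ⟨rfl, p', rfl⟩ | ⟨rfl, q', rfl⟩ | rfl
    · rw [inr_mul_inl]
      exact inr_mem_intervalDeg _
    · rw [inr_mul_inr]
      exact zero_mem _
    · rw [mul_zero]
      exact zero_mem _
  · rw [zero_mul]
    exact zero_mem _

noncomputable instance intervalGraded : GradedAlgebra intervalDeg where
  one_mem := ⟨1, rfl⟩
  mul_mem _ _ _ _ hx hy := interval_mul_mem hx hy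
  toDecomposition := interval_isInternal.chooseDecomposition

/-- `d (p + q dt) = p' dt`. -/
noncomputable def intervalD : IntervalCarrier →ₗ[ℚ] IntervalCarrier :=
  ofForm ∘ₗ Polynomial.derivative ∘ₗ fnPart

theorem intervalD_inl (p : ℚ[X]) : intervalD (inl p) = inr (Polynomial.derivative p) := rfl

theorem intervalD_inr (q : ℚ[X]) : intervalD (inr q) = 0 := by
  simp [intervalD, fnPart_apply]

/-- The CDGA `Λ(t, dt)` of polynomial differential forms on the interval. -/
noncomputable def intervalForms : CDGA.{0} where
  carrier := IntervalCarrier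
  deg := intervalDeg
  d := intervalD
  d_mem {n x} hx := by
    rcases mem_intervalDeg_cases hx with ⟨rfl, p, rfl⟩ | ⟨rfl, q, rfl⟩ | rfl
    · rw [intervalD_inl]
      exact inr_mem_intervalDeg _
    · rw [intervalD_inr]
      exact zero_mem _
    · rw [map_zero]
      exact zero_mem _
  d_d x := intervalD_inr _
  leibniz {n x} hx y := by
    rw [← inl_fst_add_inr_snd_eq y]
    rcases mem_intervalDeg_cases hx with ⟨rfl, p, rfl⟩ | ⟨rfl, q, rfl⟩ | rfl
    · rw [mul_add, map_add, map_add, ← inl_mul, inl_mul_inr, intervalD_inl, intervalD_inl,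
        intervalD_inl, intervalD_inr, intervalD_inr, mul_add, inr_mul_inl, inr_mul_inr, add_zero,
        add_zero, add_zero, inl_mul_inr, Polynomial.derivative_mul, pow_zero, one_smul,
        ← inr_add, smul_eq_mul, MulOpposite.smul_eq_mul_unop, MulOpposite.unop_op]
    · rw [mul_add, map_add, map_add, inr_mul_inl, inr_mul_inr, intervalD_inl,
        intervalD_inr, intervalD_inr, intervalD_inr, map_zero, add_zero, add_zero, inr_mul_inr,
        zero_mul, smul_zero, add_zero]
    · simp
  graded_comm {i j x y} hx hy := by
    rcases mem_intervalDeg_cases hx with ⟨rfl, p, rfl⟩ | ⟨rfl, q, rfl⟩ | rfl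
    · rw [zero_mul, pow_zero, one_smul, mul_comm]
    · rcases mem_intervalDeg_cases hy with ⟨rfl, p', rfl⟩ | ⟨rfl, q', rfl⟩ | rfl
      · rw [mul_zero, pow_zero, one_smul, mul_comm]
      · rw [inr_mul_inr, inr_mul_inr, smul_zero]
      · rw [mul_zero, zero_mul, smul_zero]
    · rw [mul_zero, zero_mul, smul_zero]

/-- Evaluation `ε_s` at `t = s`: `p + q dt ↦ p(s)`. -/
noncomputable def intervalEval (s : ℚ) : IntervalCarrier →ₐ[ℚ] ℚ :=
  (Polynomial.aeval s).comp (fstHom ℚ ℚ[X] ℚ[X])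

/-- `q ↦ ∫₀ᵗ q`, that is `t^k ↦ t^(k+1) / (k+1)`. -/
noncomputable def antiderivative : ℚ[X] →ₗ[ℚ] ℚ[X] :=
  Polynomial.lsum fun k => (1 / ((k : ℚ) + 1)) • Polynomial.monomial (k + 1)

theorem antiderivative_monomial (k : ℕ) (c : ℚ) :
    antiderivative (Polynomial.monomial k c) = Polynomial.monomial (k + 1) (c / (k + 1)) := by
  simp [antiderivative, Polynomial.sum_monomial_index, Polynomial.smul_monomial, div_eq_inv_mul]

theorem antiderivative_derivative (p : ℚ[X]) :
    antiderivative (Polynomial.derivative p) = p - Polynomial.C (p.eval 0) := by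
  induction p using Polynomial.induction_on' with
  | add p q hp hq => simp only [map_add, hp, hq, Polynomial.eval_add]; abel
  | monomial n a =>
    rcases n with _ | n
    · simp
    · have h : (n : ℚ) + 1 ≠ 0 := by positivity
      rw [Polynomial.derivative_monomial, antiderivative_monomial]
      simp [h]

/-- `∫₀ᵗ` on `Λ(t, dt)`: `t^k ↦ 0` and `t^k dt ↦ t^(k+1) / (k+1)`. -/
noncomputable def intervalIntegral : IntervalCarrier →ₗ[ℚ] IntervalCarrier :=
  ofFn ∘ₗ antiderivative ∘ₗ formPart

end Interval

/-! ### Homotopies and their integrals -/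

section Homotopy

open GradedTensorProduct

/-- `B ⊗ Λ(t, dt)`. -/
noncomputable abbrev cylinder (B : CDGA.{u}) : CDGA.{u} := B.tensor intervalForms

/-- The element `b ⊗ ω` of `B ⊗ Λ(t, dt)`. -/
noncomputable def cylTmul {B : CDGA.{u}} (b : B.carrier) (ω : IntervalCarrier) :
    B.cylinder.carrier :=
  (b ᵍ⊗ₜ[ℚ] (ω : intervalForms.carrier) : TensorCarrier B intervalForms)

/-- The variable `t`. -/
noncomputable def intervalT : IntervalCarrier := TrivSqZeroExt.inl Polynomial.X

/-- `id · ε_s : B ⊗ Λ(t, dt) → B`, `b ⊗ ω ↦ ε_s(ω) b`. -/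
noncomputable def evalAt (B : CDGA.{u}) (s : ℚ) : B.cylinder.carrier →ₗ[ℚ] B.carrier :=
  (TensorProduct.rid ℚ B.carrier).toLinearMap ∘ₗ
    TensorProduct.map LinearMap.id (intervalEval s).toLinearMap ∘ₗ
    (of ℚ B.deg intervalForms.deg).symm.toLinearMap

/-- `id ⊗ ∫₀ᵗ` on `B ⊗ Λ(t, dt)`; as `∫₀ᵗ` has degree `-1`, it sends `b ⊗ ω` to
`(-1)^|b| b ⊗ ∫₀ᵗ ω`. -/
noncomputable def fiberIntegral (B : CDGA.{u}) :
    B.cylinder.carrier →ₗ[ℚ] B.cylinder.carrier :=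
  (of ℚ B.deg intervalForms.deg).toLinearMap ∘ₗ
    TensorProduct.map B.sign intervalIntegral ∘ₗ
    (of ℚ B.deg intervalForms.deg).symm.toLinearMap

/-- `id ⊗ ∫₀¹ : B ⊗ Λ(t, dt) → B`, where `∫₀¹ = ε_1 ∘ ∫₀ᵗ`. -/
noncomputable def fiberIntegralOne (B : CDGA.{u}) : B.cylinder.carrier →ₗ[ℚ] B.carrier :=
  B.evalAt 1 ∘ₗ B.fiberIntegral

/-- A homotopy from `f` to `g`: a CDGA map `A → B ⊗ Λ(t, dt)` that restricts to `f` at `t = 0`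
and to `g` at `t = 1`. -/
structure Homotopy {A : CDGA.{u}} {B : CDGA.{u}} (f g : Hom A B) where
  toHom : Hom A B.cylinder
  eval_zero : ∀ a, B.evalAt 0 (toHom a) = f a
  eval_one : ∀ a, B.evalAt 1 (toHom a) = g a

theorem evalAt_cylTmul (B : CDGA.{u}) (s : ℚ) (b : B.carrier) (ω : IntervalCarrier) :
    B.evalAt s (cylTmul b ω) = intervalEval s ω • b := rfl

theorem fiberIntegralOne_cylTmul (B : CDGA.{u}) (b : B.carrier) (ω : IntervalCarrier) :
    B.fiberIntegralOne (cylTmul b ω) = intervalEval 1 (intervalIntegral ω) • B.sign b := rfl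

theorem cylinder_d_cylTmul (B : CDGA.{u}) (b : B.carrier) (ω : IntervalCarrier) :
    B.cylinder.d (cylTmul b ω) = cylTmul (B.d b) ω + cylTmul (B.sign b) (intervalD ω) :=
  tensorD_tmul B intervalForms b ω

theorem cylinder_induction (B : CDGA.{u}) {P : B.cylinder.carrier → Prop} (h0 : P 0)
    (hadd : ∀ x y, P x → P y → P (x + y)) (hsmul : ∀ (r : ℚ) x, P x → P (r • x))
    (h : ∀ i j, ∀ b ∈ B.deg i, ∀ ω ∈ intervalDeg j, P (cylTmul b ω)) (z : B.cylinder.carrier) :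
    P z :=
  tensor_induction B intervalForms (P := P) h0 hadd hsmul h z

theorem cylinder_deg_induction (B : CDGA.{u}) {n : ℕ} {P : B.cylinder.carrier → Prop} (h0 : P 0)
    (hadd : ∀ x y, P x → P y → P (x + y)) (hsmul : ∀ (r : ℚ) x, P x → P (r • x))
    (h : ∀ i j, i + j = n → ∀ b ∈ B.deg i, ∀ ω ∈ intervalDeg j, P (cylTmul b ω))
    {z : B.cylinder.carrier} (hz : z ∈ B.cylinder.deg n) : P z :=
  tensorDeg_induction B intervalForms (P := P) h0 hadd hsmul h hz

/-- `d ∫₀¹ + ∫₀¹ d = ε_1 - ε_0`. -/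
theorem d_fiberIntegralOne (B : CDGA.{u}) (z : B.cylinder.carrier) :
    B.d (B.fiberIntegralOne z) + B.fiberIntegralOne (B.cylinder.d z) =
      B.evalAt 1 z - B.evalAt 0 z := by
  refine B.cylinder_induction (P := fun z =>
    B.d (B.fiberIntegralOne z) + B.fiberIntegralOne (B.cylinder.d z) =
      B.evalAt 1 z - B.evalAt 0 z) ?_ ?_ ?_ ?_ z
  · simp only [map_zero, sub_zero, add_zero]
  · intro x y hx hy
    have := congrArg₂ (· + ·) hx hy
    simp only [map_add] at this ⊢
    rw [add_add_add_comm, this]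
    abel
  · intro r x hx
    simp only [map_smul, ← smul_add, ← smul_sub, hx]
  · intro i j b _ ω _
    rw [cylinder_d_cylTmul, map_add, fiberIntegralOne_cylTmul, fiberIntegralOne_cylTmul,
      fiberIntegralOne_cylTmul, evalAt_cylTmul, evalAt_cylTmul, B.sign_d, B.sign_sign, map_smul,
      smul_neg, add_neg_cancel_left, ← sub_smul]
    congr 1
    change Polynomial.aeval 1 (antiderivative (Polynomial.derivative (TrivSqZeroExt.fst ω))) =
      Polynomial.aeval 1 (TrivSqZeroExt.fst ω) - Polynomial.aeval 0 (TrivSqZeroExt.fst ω)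
    rw [antiderivative_derivative]
    simp [Polynomial.coe_aeval_eq_eval]

theorem fiberIntegralOne_mem (B : CDGA.{u}) {n : ℕ} {z : B.cylinder.carrier}
    (hz : z ∈ B.cylinder.deg (n + 1)) : B.fiberIntegralOne z ∈ B.deg n := by
  refine B.cylinder_deg_induction (P := fun z => B.fiberIntegralOne z ∈ B.deg n) ?_ ?_ ?_ ?_ hz
  · rw [map_zero]
    exact zero_mem _
  · intro x y hx hy
    rw [map_add]
    exact add_mem hx hy
  · intro r x hx
    rw [map_smul]
    exact Submodule.smul_mem _ _ hx
  · intro i j hij b hb ω hω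
    rw [fiberIntegralOne_cylTmul, B.sign_of_mem hb]
    rcases mem_intervalDeg_cases hω with ⟨rfl, p, rfl⟩ | ⟨rfl, q, rfl⟩ | rfl
    · have h : intervalIntegral (TrivSqZeroExt.inl p) = 0 := by
        simp [intervalIntegral, formPart_apply]
      rw [h, map_zero, zero_smul]
      exact zero_mem _
    · obtain rfl : i = n := by omega
      exact Submodule.smul_mem _ _ (Submodule.smul_mem _ _ hb)
    · rw [map_zero, map_zero, zero_smul]
      exact zero_mem _

end Homotopy

/-! ### Cohomology -/

section Cohomology

variable {E : Type u} [AddCommGroup E] [Module ℚ E] {E' : Type v} [AddCommGroup E'] [Module ℚ E']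

/-- Cocycles in the homogeneous part `D` of a graded complex `E` with differential `d`. -/
abbrev Cocycles (D : Submodule ℚ E) (d : E →ₗ[ℚ] E) : Submodule ℚ E := D ⊓ LinearMap.ker d

/-- Cohomology of a graded complex `E` with differential `d` at its homogeneous part `D`: cocycles
in `D` modulo coboundaries in `D`. As `d` is homogeneous, an element of `D` that lies in the image
of `d` is the differential of an element of the preceding degree. -/
abbrev Cohomology (D : Submodule ℚ E) (d : E →ₗ[ℚ] E) : Type u :=
  ↥(Cocycles D d) ⧸ (LinearMap.range d).submoduleOf (Cocycles D d)

/-- The map induced on cohomology by a cochain map. -/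
def cohomologyMap {D : Submodule ℚ E} {d : E →ₗ[ℚ] E} {D' : Submodule ℚ E'} {d' : E' →ₗ[ℚ] E'}
    (F : E →ₗ[ℚ] E') (hD : ∀ x ∈ D, F x ∈ D') (hd : ∀ x, F (d x) = d' (F x)) :
    Cohomology D d →ₗ[ℚ] Cohomology D' d' :=
  Submodule.mapQ _ _
    (F.restrict (p := Cocycles D d) (q := Cocycles D' d') fun x hx =>
      ⟨hD x hx.1, by
        have h : d x = 0 := hx.2
        change d' (F x) = 0
        rw [← hd, h, map_zero]⟩)
    (by
      rintro ⟨x, hx⟩ ⟨y, hy⟩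
      exact ⟨F y, (hd y).symm.trans (congrArg F hy)⟩)

end Cohomology

/-- `H^n(A)`. -/
abbrev H (A : CDGA.{u}) (n : ℕ) : Type u := Cohomology (A.deg n) A.d

/-- `H^n(f) : H^n(A) → H^n(B)`. -/
def Hom.mapH {A B : CDGA.{u}} (f : Hom A B) (n : ℕ) : A.H n →ₗ[ℚ] B.H n :=
  cohomologyMap f.toAlgHom.toLinearMap (fun _ => f.map_deg) f.map_d

/-- `A` is connected, `H^0(A) = ℚ`: every cocycle of degree `0` is a unique rational multiple
of the unit. (There are no nonzero coboundaries of degree `0`.) -/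
def Connected (A : CDGA.{u}) : Prop :=
  ∀ a ∈ A.deg 0, A.d a = 0 → ∃! q : ℚ, algebraMap ℚ A.carrier q = a

/-- `A` is simply connected: `H^0(A) = ℚ` and `H^1(A) = 0`. -/
def SimplyConnected (A : CDGA.{u}) : Prop := A.Connected ∧ Subsingleton (A.H 1)

/-- `f` is `n`-connected: it is an isomorphism on cohomology in degrees `< n` and injective on
cohomology in degree `n`. -/
def Hom.IsConnected {A B : CDGA.{u}} (f : Hom A B) (n : ℕ) : Prop :=
  (∀ i < n, Function.Bijective (f.mapH i)) ∧ Function.Injective (f.mapH n)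

/-! ### Hirsch extensions and minimal algebras -/

/-- A Hirsch extension `M → M⟨V⟩ = M'` of degree `k` along the vector space `V`, with attaching map
`d : V → M` of degree `k + 1`: the elements of `V` are adjoined as generators of degree `k`
with the prescribed differentials. The last field says that the square
`Λ S^(k+1)(V) → M`, `Λ D^(k+1)(V) → M'` is a pushout of CDGAs: a map `Λ S^(k+1)(V) → C` is a
linear map from `V` to the cocycles of `C` of degree `k + 1`, and a map `Λ D^(k+1)(V) → C` is a
linear map from `V` to the elements of `C` of degree `k`. -/
structure HirschExtension (k : ℕ) (V : Type u) [AddCommGroup V] [Module ℚ V]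
    (M M' : CDGA.{u}) where
  incl : Hom M M'
  attach : V →ₗ[ℚ] M.carrier
  gen : V →ₗ[ℚ] M'.carrier
  attach_mem : ∀ v, attach v ∈ M.deg (k + 1)
  d_attach : ∀ v, M.d (attach v) = 0
  gen_mem : ∀ v, gen v ∈ M'.deg k
  d_gen : ∀ v, M'.d (gen v) = incl (attach v)
  isPushout : ∀ (C : CDGA.{u}) (φ : Hom M C) (θ : V →ₗ[ℚ] C.carrier), (∀ v, θ v ∈ C.deg k) →
    (∀ v, C.d (θ v) = φ (attach v)) →
      ∃! ψ : Hom M' C, (∀ x, ψ (incl x) = φ x) ∧ ∀ v, ψ (gen v) = θ v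

/-- `k`-minimal algebras: CDGAs `M` with a filtration `ℚ = M_0 → M_1 → ⋯ → M_k = M` in which
each `M_(j-1) → M_j` is a Hirsch extension of degree `j`. -/
inductive IsMinimalAlgebra : ℕ → CDGA.{u} → Prop
  | base (M : CDGA.{u}) (h : Function.Bijective (algebraMap ℚ M.carrier)) : IsMinimalAlgebra 0 M
  | step {k : ℕ} {M M' : CDGA.{u}} {V : Type u} [AddCommGroup V] [Module ℚ V]
      (E : HirschExtension (k + 1) V M M') (h : IsMinimalAlgebra k M) : IsMinimalAlgebra (k + 1) M'

/-- `m : M → A` is a `k`-minimal model of `A`: a `(k + 1)`-connected map from a `k`-minimal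
algebra. -/
def Hom.IsMinimalModel {M A : CDGA.{u}} (m : Hom M A) (k : ℕ) : Prop :=
  IsMinimalAlgebra k M ∧ m.IsConnected (k + 1)

/-! ### Indecomposables -/

/-- The ideal of elements of positive degree. -/
def augIdeal (M : CDGA.{u}) : Submodule ℚ M.carrier := ⨆ n, M.deg (n + 1)

/-- The degree `k ≥ 1` part of the indecomposables, the quotient of the elements of positive degree
by the sums of products of two elements of positive degree. -/
abbrev Q (M : CDGA.{u}) (k : ℕ) : Type u :=
  ↥(M.deg k) ⧸ (M.augIdeal * M.augIdeal).submoduleOf (M.deg k)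

theorem Hom.map_augIdeal {M N : CDGA.{u}} (g : Hom M N) {x : M.carrier} (hx : x ∈ M.augIdeal) :
    g x ∈ N.augIdeal := by
  have h : M.augIdeal ≤ N.augIdeal.comap g.toAlgHom.toLinearMap :=
    iSup_le fun n y hy => Submodule.mem_iSup_of_mem n (g.map_deg hy)
  exact h hx

/-- The map `Q^k(g)` induced by `g` on the degree `k` part of the indecomposables. -/
def Hom.mapQ {M N : CDGA.{u}} (g : Hom M N) (k : ℕ) : M.Q k →ₗ[ℚ] N.Q k :=
  Submodule.mapQ _ _
    (g.toAlgHom.toLinearMap.restrict (p := M.deg k) (q := N.deg k) fun _ => g.map_deg)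
    (by
      rintro ⟨x, hx⟩ (h : x ∈ M.augIdeal * M.augIdeal)
      change g x ∈ N.augIdeal * N.augIdeal
      refine Submodule.mul_induction_on (C := fun x => g x ∈ N.augIdeal * N.augIdeal) h ?_ ?_
      · intro a ha b hb
        rw [map_mul]
        exact Submodule.mul_mem_mul (g.map_augIdeal ha) (g.map_augIdeal hb)
      · intro a b ha hb
        rw [map_add]
        exact add_mem ha hb)

/-- The canonical map `V → Q^k(M⟨V⟩)` for a Hirsch extension of degree `k`. -/
def HirschExtension.toQ {k : ℕ} {V : Type u} [AddCommGroup V] [Module ℚ V] {M M' : CDGA.{u}}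
    (E : HirschExtension k V M M') : V →ₗ[ℚ] M'.Q k :=
  Submodule.mkQ _ ∘ₗ E.gen.codRestrict (M'.deg k) E.gen_mem

/-! ### Mapping cones -/

/-- The differential `d (a, b) = (d a, m a - d b)` of the mapping cone `C_m` of (the cochain map
underlying) `m : M → A`. -/
def coneD {M A : CDGA.{u}} (m : Hom M A) :
    M.carrier × A.carrier →ₗ[ℚ] M.carrier × A.carrier :=
  (M.d ∘ₗ LinearMap.fst ℚ M.carrier A.carrier).prod
    (m.toAlgHom.toLinearMap ∘ₗ LinearMap.fst ℚ M.carrier A.carrier -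
      A.d ∘ₗ LinearMap.snd ℚ M.carrier A.carrier)

theorem coneD_apply {M A : CDGA.{u}} (m : Hom M A) (a : M.carrier) (b : A.carrier) :
    coneD m (a, b) = (M.d a, m a - A.d b) := rfl

/-- The degree `n` part `C_m^n = M^(n+1) ⊕ A^n` of the cone, for `n ≥ 0`; besides these, the cone
has the part `C_m^(-1) = M^0 ⊕ 0`. -/
def coneDeg {M A : CDGA.{u}} (_m : Hom M A) (n : ℕ) : Submodule ℚ (M.carrier × A.carrier) :=
  (M.deg (n + 1)).prod (A.deg n)

/-- `Z^n(C_m)`. -/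
abbrev coneZ {M A : CDGA.{u}} (m : Hom M A) (n : ℕ) : Submodule ℚ (M.carrier × A.carrier) :=
  Cocycles (coneDeg m n) (coneD m)

/-- `H^n(C_m)`. -/
abbrev coneH {M A : CDGA.{u}} (m : Hom M A) (n : ℕ) : Type u :=
  Cohomology (coneDeg m n) (coneD m)

/-- `(a, b)` is a cocycle of degree `n` of the cone `C_m` that represents the class `α`. -/
def Represents {M A : CDGA.{u}} (m : Hom M A) (n : ℕ) (a : M.carrier) (b : A.carrier)
    (α : coneH m n) : Prop :=
  ∃ h : (a, b) ∈ coneZ m n, Submodule.Quotient.mk ⟨(a, b), h⟩ = α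

/-! ### Minimal models of maps -/

/-- A `k`-minimal model of a map `f : A → B`: a map `g : M → N`, `k`-minimal models `m : M → A` and
`n : N → B`, and a homotopy `H` from `f m` to `n g`. -/
structure MinimalModelOfMap {A B : CDGA.{u}} (f : Hom A B) (k : ℕ) where
  M : CDGA.{u}
  N : CDGA.{u}
  g : Hom M N
  m : Hom M A
  n : Hom N B
  H : Homotopy (f.comp m) (n.comp g)
  m_minimal : m.IsMinimalModel k
  n_minimal : n.IsMinimalModel k

namespace MinimalModelOfMap

variable {A B : CDGA.{u}} {f : Hom A B} {k : ℕ} (S : MinimalModelOfMap f k)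

/-- The underlying cochain homotopy `∫₀¹ H : M → B`, of degree `-1`. -/
noncomputable def intH : S.M.carrier →ₗ[ℚ] B.carrier :=
  B.fiberIntegralOne ∘ₗ S.H.toHom.toAlgHom.toLinearMap

/-- `∫₀ᵗ H : M → B ⊗ Λ(t, dt)`, of degree `-1`. -/
noncomputable def intHt : S.M.carrier →ₗ[ℚ] B.cylinder.carrier :=
  B.fiberIntegral ∘ₗ S.H.toHom.toAlgHom.toLinearMap

theorem d_intH (a : S.M.carrier) :
    B.d (S.intH a) + S.intH (S.M.d a) = S.n (S.g a) - f (S.m a) := by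
  have h := B.d_fiberIntegralOne (S.H.toHom a)
  rw [S.H.eval_one, S.H.eval_zero, ← S.H.toHom.map_d] at h
  exact h

/-- The induced map on cones `φ : C_m → C_n`, `φ (a, b) = (g a, f b + ∫₀¹ H a)`. -/
noncomputable def coneMap :
    S.M.carrier × A.carrier →ₗ[ℚ] S.N.carrier × B.carrier :=
  (S.g.toAlgHom.toLinearMap ∘ₗ LinearMap.fst ℚ S.M.carrier A.carrier).prod
    (f.toAlgHom.toLinearMap ∘ₗ LinearMap.snd ℚ S.M.carrier A.carrier +
      S.intH ∘ₗ LinearMap.fst ℚ S.M.carrier A.carrier)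

theorem coneMap_apply (a : S.M.carrier) (b : A.carrier) :
    S.coneMap (a, b) = (S.g a, f b + S.intH a) := rfl

theorem coneMap_mem {n : ℕ} (x : S.M.carrier × A.carrier) (hx : x ∈ coneDeg S.m n) :
    S.coneMap x ∈ coneDeg S.n n :=
  ⟨S.g.map_deg hx.1,
    add_mem (f.map_deg hx.2) (B.fiberIntegralOne_mem (S.H.toHom.map_deg hx.1))⟩

theorem coneMap_d (x : S.M.carrier × A.carrier) :
    S.coneMap (coneD S.m x) = coneD S.n (S.coneMap x) := by
  obtain ⟨a, b⟩ := x
  rw [coneD_apply, coneMap_apply, coneMap_apply, coneD_apply, S.g.map_d, map_sub, f.map_d,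
    map_add, eq_sub_of_add_eq (S.d_intH a)]
  congr 1
  abel

/-- `H^n(φ) : H^n(C_m) → H^n(C_n)`. -/
noncomputable def mapConeH (n : ℕ) : coneH S.m n →ₗ[ℚ] coneH S.n n :=
  cohomologyMap S.coneMap S.coneMap_mem S.coneMap_d

end MinimalModelOfMap

end CDGA

namespace CDGA

/-! ### Free graded commutative algebras -/

/-! A class in `H^k C_m` is represented by a pair `(a, b)` with `d a = 0` and `m a = d b`. This is
exactly the data needed to adjoin a generator with differential `a` and to send it to `b`. A linear
choice `s` of cocycle representatives for `V` therefore defines both `M⟨V⟩` and the extension of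
`m`; a choice `t` for `W` does the same for `n`. Adjoining all of `H^k C_m` makes the map an
isomorphism on `H^k` and injective on `H^(k+1)`: a cohomology class that fails to be hit or to
inject is a class of the cone, hence is hit or killed by a generator. Simple connectivity gives `M^1
= 0`, so `M⟨V⟩` has nothing new in degree `k + 1`. This is `isConnected_of_section`.

For the map, split `V` as `ker ψ` plus a complement `U`. As `ψ` is injective on `U`, the section `t`
can be chosen with `t ψ = φ s` on `U` (`exists_section_extending`). On `ker ψ` the cocycle `φ (s α)`
is exact, and primitives `p α = (x, y)` can be chosen linearly (`exists_linear_lift`). Extending `p`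
by zero on `U` gives one identity on all of `V`, namely `t ψ + d p = φ s`. Its first component says
that `v ↦ ψ v + x` is compatible with differentials, so that `g` extends. Its second component says
that the homotopy `f m v ⊗ 1 + ∫₀ᵗ H (d v) + d (y ⊗ t)`, which starts at `f m`, ends at `n g`.
Finally `x` lies in `N^k`, which is decomposable because `N` is `(k-1)`-minimal, so `Q^k` of the new
map is `ψ`.

The extension `M⟨V⟩` is realised on `M ⊗ Λ V`. Its differential is obtained as the corner entry of
an algebra map into upper triangular 2 by 2 matrices, so that the Leibniz rule is multiplicativity
and well-definedness is a check on generators. -/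

/-- The relation `v w = (-1)^(k k) w v` on the tensor algebra. -/
inductive FreeRel (k : ℕ) (V : Type u) [AddCommGroup V] [Module ℚ V] :
    TensorAlgebra ℚ V → TensorAlgebra ℚ V → Prop
  | swap (v w : V) : FreeRel k V (TensorAlgebra.ι ℚ v * TensorAlgebra.ι ℚ w)
      ((-1 : ℚ) ^ (k * k) • (TensorAlgebra.ι ℚ w * TensorAlgebra.ι ℚ v))

/-- The free graded commutative algebra on a vector space `V` of generators of degree `k`. -/
def FreeGC (k : ℕ) (V : Type u) [AddCommGroup V] [Module ℚ V] : Type u := RingQuot (FreeRel k V)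

namespace FreeGC

variable (k : ℕ) (V : Type u) [AddCommGroup V] [Module ℚ V]

noncomputable instance : Ring (FreeGC k V) := inferInstanceAs (Ring (RingQuot (FreeRel k V)))

noncomputable instance : Algebra ℚ (FreeGC k V) :=
  inferInstanceAs (Algebra ℚ (RingQuot (FreeRel k V)))

/-- The quotient map from the tensor algebra. -/
noncomputable def mk : TensorAlgebra ℚ V →ₐ[ℚ] FreeGC k V := RingQuot.mkAlgHom ℚ (FreeRel k V)

theorem mk_surjective : Function.Surjective (mk k V) :=
  RingQuot.mkAlgHom_surjective ℚ (FreeRel k V)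

/-- The inclusion of the generators. -/
noncomputable def ι : V →ₗ[ℚ] FreeGC k V := (mk k V).toLinearMap ∘ₗ TensorAlgebra.ι ℚ

theorem ι_mul_ι (v w : V) : ι k V v * ι k V w = (-1 : ℚ) ^ (k * k) • (ι k V w * ι k V v) := by
  have h := RingQuot.mkAlgHom_rel ℚ (FreeRel.swap (k := k) v w)
  change mk k V _ = mk k V _ at h
  rwa [map_mul, map_smul, map_mul] at h

variable {V}

/-- The algebra map determined by its values on the generators. -/
noncomputable def lift {C : Type v} [Ring C] [Algebra ℚ C] (θ : V →ₗ[ℚ] C)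
    (h : ∀ v w, θ v * θ w = (-1 : ℚ) ^ (k * k) • (θ w * θ v)) : FreeGC k V →ₐ[ℚ] C :=
  RingQuot.liftAlgHom ℚ (s := FreeRel k V) ⟨TensorAlgebra.lift ℚ θ, by
    rintro _ _ ⟨v, w⟩
    simpa using h v w⟩

theorem lift_ι {C : Type v} [Ring C] [Algebra ℚ C] (θ : V →ₗ[ℚ] C)
    (h : ∀ v w, θ v * θ w = (-1 : ℚ) ^ (k * k) • (θ w * θ v)) (v : V) :
    lift k θ h (ι k V v) = θ v := by
  have e := RingQuot.liftAlgHom_mkAlgHom_apply ℚ (TensorAlgebra.lift ℚ θ) (s := FreeRel k V) (by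
    rintro _ _ ⟨v, w⟩
    simpa using h v w) (TensorAlgebra.ι ℚ v)
  rw [TensorAlgebra.lift_ι_apply] at e
  exact e

theorem induction {P : FreeGC k V → Prop} (hadd : ∀ x y, P x → P y → P (x + y))
    (hsmul : ∀ (r : ℚ) x, P x → P (r • x)) (hone : P 1)
    (hmul : ∀ x v, P x → P (x * ι k V v)) (x : FreeGC k V) : P x := by
  obtain ⟨t, rfl⟩ := mk_surjective k V x
  -- The statement is generalised to right multiples of any `y` satisfying `P`, so that the product
  -- case of the tensor algebra composes.
  suffices h : ∀ y, P y → P (y * mk k V t) by simpa using h 1 hone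
  induction t using TensorAlgebra.induction with
  | algebraMap r =>
    intro y hy
    rw [AlgHom.commutes, ← Algebra.commutes, ← Algebra.smul_def]
    exact hsmul r y hy
  | ι v => exact fun y hy => hmul y v hy
  | mul a b ha hb =>
    intro y hy
    rw [map_mul, ← mul_assoc]
    exact hb _ (ha _ hy)
  | add a b ha hb =>
    intro y hy
    rw [map_add, mul_add]
    exact hadd _ _ (ha _ hy) (hb _ hy)

variable (V)

/-- The coaction `v ↦ v X^k` that encodes the grading. -/
noncomputable def coaction : FreeGC k V →ₐ[ℚ] (FreeGC k V)[X] :=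
  lift k ((Polynomial.monomial k).restrictScalars ℚ ∘ₗ ι k V) (by
    intro v w
    simp only [LinearMap.comp_apply, LinearMap.restrictScalars_apply,
      Polynomial.monomial_mul_monomial, Polynomial.smul_monomial]
    rw [ι_mul_ι])

variable {V} in
theorem coaction_ι (v : V) : coaction k V (ι k V v) = Polynomial.monomial k (ι k V v) :=
  lift_ι k _ _ v

/-- The homogeneous elements of degree `n`. -/
noncomputable def deg (n : ℕ) : Submodule ℚ (FreeGC k V) :=
  LinearMap.eqLocus (coaction k V).toLinearMap ((Polynomial.monomial n).restrictScalars ℚ)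

variable {V}

theorem mem_deg {n : ℕ} {x : FreeGC k V} :
    x ∈ deg k V n ↔ coaction k V x = Polynomial.monomial n x := Iff.rfl

theorem one_mem_deg : (1 : FreeGC k V) ∈ deg k V 0 := by
  rw [mem_deg, map_one, Polynomial.monomial_zero_one]

theorem ι_mem_deg (v : V) : ι k V v ∈ deg k V k := coaction_ι k v

theorem mul_mem_deg {m n : ℕ} {x y : FreeGC k V} (hx : x ∈ deg k V m) (hy : y ∈ deg k V n) :
    x * y ∈ deg k V (m + n) := by
  rw [mem_deg] at *
  rw [map_mul, hx, hy, Polynomial.monomial_mul_monomial]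

/-- The coefficient of `X^n` in the coaction is the component of degree `n`. Working with
coefficients allows an induction over monomials that keeps track of degrees although intermediate
elements are not homogeneous. -/
theorem coeff_coaction_induction {P : ℕ → FreeGC k V → Prop} (h0 : ∀ n, P n 0)
    (hadd : ∀ n x y, P n x → P n y → P n (x + y)) (hsmul : ∀ n (r : ℚ) x, P n x → P n (r • x))
    (hone : P 0 1) (hmul : ∀ n x v, P n x → P (n + k) (x * ι k V v)) (x : FreeGC k V) (n : ℕ) :
    P n ((coaction k V x).coeff n) := by
  revert n
  refine induction k (P := fun x => ∀ n, P n ((coaction k V x).coeff n)) ?_ ?_ ?_ ?_ x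
  · intro x y hx hy n
    rw [map_add, Polynomial.coeff_add]
    exact hadd n _ _ (hx n) (hy n)
  · intro r x hx n
    rw [map_smul, Polynomial.coeff_smul]
    exact hsmul n r _ (hx n)
  · intro n
    rw [map_one, Polynomial.coeff_one]
    split_ifs with h
    · subst h
      exact hone
    · exact h0 n
  · intro x v hx n
    rw [map_mul, coaction_ι, ← Polynomial.C_mul_X_pow_eq_monomial, ← mul_assoc,
      Polynomial.coeff_mul_X_pow']
    split_ifs with h
    · rw [Polynomial.coeff_mul_C]
      have := hmul _ _ v (hx (n - k))
      rwa [Nat.sub_add_cancel h] at this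
    · exact h0 n

/-- For homogeneous `x` the coefficient of `X^n` in the coaction is `x` itself. Homogeneity is
carried along inside the predicate. -/
theorem deg_induction {P : ℕ → FreeGC k V → Prop} (h0 : ∀ n, P n 0)
    (hadd : ∀ n x y, P n x → P n y → P n (x + y)) (hsmul : ∀ n (r : ℚ) x, P n x → P n (r • x))
    (hone : P 0 1) (hmul : ∀ n x v, x ∈ deg k V n → P n x → P (n + k) (x * ι k V v))
    {n : ℕ} {x : FreeGC k V} (hx : x ∈ deg k V n) : P n x := by
  have h := coeff_coaction_induction k (P := fun n x => x ∈ deg k V n ∧ P n x)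
    (fun n => ⟨zero_mem _, h0 n⟩) (fun n x y hx hy => ⟨add_mem hx.1 hy.1, hadd n x y hx.2 hy.2⟩)
    (fun n r x hx => ⟨Submodule.smul_mem _ r hx.1, hsmul n r x hx.2⟩) ⟨one_mem_deg k, hone⟩
    (fun n x v hx => ⟨mul_mem_deg k hx.1 (ι_mem_deg k v), hmul n x v hx.1 hx.2⟩) x n
  rw [(mem_deg k).1 hx, Polynomial.coeff_monomial_same] at h
  exact h.2

variable (V)

/-- Taking the coefficient of `X^n` in the coaction is a projection onto degree `n`, which gives
independence at once. Only spanning needs an induction over monomials. -/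
theorem isInternal : DirectSum.IsInternal (deg k V) := by
  refine isInternal_of_proj _
    (fun n => (Polynomial.lcoeff _ n).restrictScalars ℚ ∘ₗ (coaction k V).toLinearMap) ?_ ?_ ?_
  · intro x
    refine induction k (P := fun x => ∀ n, x ∈ ⨆ n, deg k V n) ?_ ?_ ?_ ?_ x 0
    · exact fun x y hx hy n => add_mem (hx n) (hy n)
    · exact fun r x hx n => Submodule.smul_mem _ r (hx n)
    · exact fun _ => Submodule.mem_iSup_of_mem 0 (one_mem_deg k)
    · intro x v hx _
      refine Submodule.iSup_induction (deg k V)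
        (motive := fun x => x * ι k V v ∈ ⨆ n, deg k V n) (hx 0) ?_ ?_ ?_
      · exact fun n y hy => Submodule.mem_iSup_of_mem (n + k) (mul_mem_deg k hy (ι_mem_deg k v))
      · rw [zero_mul]
        exact zero_mem _
      · intro y z hy hz
        rw [add_mul]
        exact add_mem hy hz
  · intro n x hx
    change (coaction k V x).coeff n = x
    rw [(mem_deg k).1 hx, Polynomial.coeff_monomial_same]
  · intro m n hmn x hx
    change (coaction k V x).coeff n = 0
    rw [(mem_deg k).1 hx, Polynomial.coeff_monomial_of_ne _ hmn.symm]

noncomputable instance : GradedAlgebra (deg k V) where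
  one_mem := one_mem_deg k
  mul_mem _ _ _ _ hx hy := mul_mem_deg k hx hy
  toDecomposition := (isInternal k V).chooseDecomposition

variable {V}

theorem mul_ι_comm {n : ℕ} {x : FreeGC k V} (hx : x ∈ deg k V n) (v : V) :
    x * ι k V v = (-1 : ℚ) ^ (n * k) • (ι k V v * x) := by
  refine deg_induction k (P := fun n x => x * ι k V v = (-1 : ℚ) ^ (n * k) • (ι k V v * x))
    ?_ ?_ ?_ ?_ ?_ hx
  · simp
  · intro n x y hx hy
    rw [add_mul, hx, hy, mul_add, smul_add]
  · intro n r x hx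
    rw [smul_mul_assoc, hx, mul_smul_comm, smul_comm]
  · simp
  · intro n x w _ hx
    rw [mul_assoc, ι_mul_ι, mul_smul_comm, ← mul_assoc, hx, smul_mul_assoc, smul_smul, mul_assoc,
      add_mul, pow_add, mul_comm]

theorem mul_comm_of_mem {m n : ℕ} {x y : FreeGC k V} (hx : x ∈ deg k V m) (hy : y ∈ deg k V n) :
    x * y = (-1 : ℚ) ^ (m * n) • (y * x) := by
  refine deg_induction k (P := fun n y => x * y = (-1 : ℚ) ^ (m * n) • (y * x))
    ?_ ?_ ?_ ?_ ?_ hy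
  · simp
  · intro n x y hx hy
    rw [mul_add, hx, hy, add_mul, smul_add]
  · intro n r x hx
    rw [mul_smul_comm, hx, smul_mul_assoc, smul_comm]
  · simp
  · intro n y w _ hy
    rw [← mul_assoc, hy, smul_mul_assoc, mul_assoc, mul_ι_comm k hx, mul_smul_comm, smul_smul,
      mul_add, pow_add, mul_assoc]

end FreeGC

/-- The free graded commutative algebra `Λ V` on generators of degree `k`, with zero
differential. -/
noncomputable def free (k : ℕ) (V : Type u) [AddCommGroup V] [Module ℚ V] : CDGA.{u} where
  carrier := FreeGC k V
  deg := FreeGC.deg k V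
  d := 0
  d_mem _ := zero_mem _
  d_d _ := rfl
  leibniz _ _ := by simp
  graded_comm hx hy := FreeGC.mul_comm_of_mem k hx hy

theorem mem_augIdeal (M : CDGA.{u}) {n : ℕ} (hn : 0 < n) {x : M.carrier} (hx : x ∈ M.deg n) :
    x ∈ M.augIdeal := by
  obtain ⟨n, rfl⟩ := Nat.exists_eq_succ_of_ne_zero hn.ne'
  exact Submodule.mem_iSup_of_mem n hx

theorem sign_mul (A : CDGA.{u}) (a b : A.carrier) : A.sign (a * b) = A.sign a * A.sign b := by
  refine A.induction_homogeneous (P := fun a => A.sign (a * b) = A.sign a * A.sign b) (by simp)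
    (fun x y hx hy => by simp only [add_mul, map_add, hx, hy]) (fun i a ha => ?_) a
  refine A.induction_homogeneous (P := fun b => A.sign (a * b) = A.sign a * A.sign b) (by simp)
    (fun x y hx hy => by simp only [mul_add, map_add, hx, hy]) (fun j b hb => ?_) b
  rw [A.sign_of_mem ha, A.sign_of_mem hb, A.sign_of_mem (SetLike.mul_mem_graded ha hb),
    smul_mul_smul_comm, pow_add]

theorem one_mem (A : CDGA.{u}) : (1 : A.carrier) ∈ A.deg 0 := SetLike.one_mem_graded A.deg

theorem sign_one (A : CDGA.{u}) : A.sign 1 = 1 := by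
  rw [A.sign_of_mem A.one_mem, pow_zero, one_smul]

theorem sign_mem (A : CDGA.{u}) {n : ℕ} {a : A.carrier} (ha : a ∈ A.deg n) :
    A.sign a ∈ A.deg n := by
  rw [A.sign_of_mem ha]
  exact Submodule.smul_mem _ _ ha

/-- With the sign involution in place of `(-1)^n`, the Leibniz rule needs no homogeneity. In this
form it is the corner entry of a product of triangular matrices. -/
theorem d_mul (A : CDGA.{u}) (a b : A.carrier) : A.d (a * b) = A.d a * b + A.sign a * A.d b := by
  refine A.induction_homogeneous (P := fun a => A.d (a * b) = A.d a * b + A.sign a * A.d b)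
    (by simp) (fun x y hx hy => by simp only [add_mul, map_add, hx, hy]; abel) (fun i a ha => ?_) a
  rw [A.leibniz ha, A.sign_of_mem ha, smul_mul_assoc]

theorem d_one (A : CDGA.{u}) : A.d 1 = 0 := by
  have h := A.leibniz A.one_mem 1
  simpa using h

/-! ### The free Hirsch extension -/

namespace Hirsch

open GradedTensorProduct

variable (M : CDGA.{u}) (k : ℕ) {V : Type u} [AddCommGroup V] [Module ℚ V]

variable (V) in
/-- The underlying graded algebra `M ⊗ Λ V`, with the differential that vanishes on `V`. -/
noncomputable abbrev T : CDGA.{u} := M.tensor (free k V)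

variable (V) in
/-- `a ↦ a ⊗ 1`. -/
noncomputable def inl : M.carrier →ₐ[ℚ] (T M k V).carrier := includeLeft M.deg (free k V).deg

/-- `v ↦ 1 ⊗ v`. -/
noncomputable def gen : V →ₗ[ℚ] (T M k V).carrier :=
  (includeRight M.deg (free k V).deg).toLinearMap ∘ₗ FreeGC.ι k V

/-- `(a, b) ↦ a ⊗ b`. -/
noncomputable def tm : M.carrier →ₗ[ℚ] FreeGC k V →ₗ[ℚ] (T M k V).carrier :=
  (TensorProduct.mk ℚ M.carrier (free k V).carrier).compr₂
    (of ℚ M.deg (free k V).deg).toLinearMap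

theorem tm_one (a : M.carrier) : tm M k a (1 : FreeGC k V) = inl M k V a := rfl

theorem tm_mem {i j : ℕ} {a : M.carrier} {b : FreeGC k V} (ha : a ∈ M.deg i)
    (hb : b ∈ FreeGC.deg k V j) : tm M k a b ∈ (T M k V).deg (i + j) :=
  tmul_mem_tensorDeg M (free k V) ha hb

theorem inl_mem {n : ℕ} {a : M.carrier} (ha : a ∈ M.deg n) : inl M k V a ∈ (T M k V).deg n := by
  have h := tm_mem M k ha (FreeGC.one_mem_deg k (V := V))
  rwa [tm_one, add_zero] at h

theorem gen_mem (v : V) : gen M k v ∈ (T M k V).deg k := by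
  have h := tm_mem M k M.one_mem (FreeGC.ι_mem_deg k v)
  rwa [zero_add] at h

/-- No sign appears, since the generator is `1 ⊗ v` and the factor `1` crossing `b` has degree `0`.
-/
theorem tm_mul_gen (a : M.carrier) (b : FreeGC k V) (v : V) :
    tm M k a (b * FreeGC.ι k V v) = tm M k a b * gen M k v := by
  let P : FreeGC k V → Prop := fun b => tm M k a (b * FreeGC.ι k V v) = tm M k a b * gen M k v
  refine (free k V).induction_homogeneous (P := P) ?_ ?_ ?_ b
  · change tm M k a ((0 : FreeGC k V) * FreeGC.ι k V v) = tm M k a (0 : FreeGC k V) * gen M k v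
    rw [zero_mul, map_zero, zero_mul]
  · intro (b : FreeGC k V) (c : FreeGC k V) hb hc
    change tm M k a ((b + c) * FreeGC.ι k V v) = tm M k a (b + c) * gen M k v
    rw [add_mul, map_add, hb, hc, map_add, add_mul]
  · intro j b hb
    have h := tmul_mul_tmul M (free k V) a hb M.one_mem (FreeGC.ι k V v)
    rw [mul_zero, pow_zero, one_smul, mul_one] at h
    exact h.symm

/-- Induction over the monomials `a v_1 ⋯ v_l`, in each degree. -/
theorem deg_induction {P : ℕ → (T M k V).carrier → Prop} (h0 : ∀ n, P n 0)
    (hadd : ∀ n x y, P n x → P n y → P n (x + y)) (hsmul : ∀ n (r : ℚ) x, P n x → P n (r • x))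
    (hinl : ∀ n, ∀ a ∈ M.deg n, P n (inl M k V a))
    (hgen : ∀ n, ∀ x ∈ (T M k V).deg n, ∀ v, P n x → P (n + k) (x * gen M k v))
    {n : ℕ} {x : (T M k V).carrier} (hx : x ∈ (T M k V).deg n) : P n x := by
  refine tensorDeg_induction M (free k V) (P := P n) (h0 n) (hadd n) (hsmul n) ?_ hx
  rintro i j rfl a ha b hb
  change P (i + j) (tm M k a b)
  refine FreeGC.deg_induction k
    (P := fun j b => P (i + j) (tm M k a b)) ?_ ?_ ?_ ?_ ?_ hb
  · intro j
    rw [map_zero]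
    exact h0 _
  · intro j b c hb hc
    rw [map_add]
    exact hadd _ _ _ hb hc
  · intro j r b hb
    rw [map_smul]
    exact hsmul _ _ _ hb
  · exact hinl i a ha
  · intro j b v hbj hb
    rw [tm_mul_gen, ← add_assoc]
    exact hgen _ _ (tm_mem M k ha hbj) v hb

theorem induction {P : (T M k V).carrier → Prop}
    (hadd : ∀ x y, P x → P y → P (x + y)) (hsmul : ∀ (r : ℚ) x, P x → P (r • x))
    (hinl : ∀ a, P (inl M k V a)) (hgen : ∀ x v, P x → P (x * gen M k v))
    (x : (T M k V).carrier) : P x := by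
  have h0 : P 0 := by simpa using hinl 0
  refine (T M k V).induction_homogeneous h0 hadd (fun n x hx => ?_) x
  exact deg_induction M k (P := fun _ x => P x) (fun _ => h0) (fun _ => hadd) (fun _ => hsmul)
    (fun _ a _ => hinl a) (fun _ x _ v => hgen x v) hx

variable (δ : V →ₗ[ℚ] M.carrier)

variable (V) in
/-- The algebra map `a ↦ (±a, d a; 0, a)` that encodes the differential of `M`. -/
noncomputable def matLeft : M.carrier →ₐ[ℚ] Matrix (Fin 2) (Fin 2) (T M k V).carrier :=
  AlgHom.ofLinearMap
    { toFun := fun a => !![inl M k V (M.sign a), inl M k V (M.d a); 0, inl M k V a]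
      map_add' := fun a b => by
        ext i j
        fin_cases i <;> fin_cases j <;> simp
      map_smul' := fun r a => by
        ext i j
        fin_cases i <;> fin_cases j <;> simp }
    (by
      ext i j
      fin_cases i <;> fin_cases j <;> simp [M.sign_one, M.d_one])
    -- The corner entry of the product is `± a * d b + d a * b`, which is `d (a * b)`; the diagonal
    -- uses that the sign involution is multiplicative.
    (fun a b => by
      ext i j
      fin_cases i <;> fin_cases j <;> simp [M.sign_mul, M.d_mul, add_comm])

theorem matLeft_apply (a : M.carrier) :
    matLeft M k V a = !![inl M k V (M.sign a), inl M k V (M.d a); 0, inl M k V a] := rfl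

/-- The matrix `(± v, δ v; 0, v)`. -/
noncomputable def matGen : V →ₗ[ℚ] Matrix (Fin 2) (Fin 2) (T M k V).carrier where
  toFun v := !![(-1 : ℚ) ^ k • gen M k v, inl M k V (δ v); 0, gen M k v]
  map_add' := fun a b => by
    ext i j
    fin_cases i <;> fin_cases j <;> simp
  map_smul' := fun r a => by
    ext i j
    fin_cases i <;> fin_cases j <;> simp [smul_comm r]

theorem matGen_apply (v : V) :
    matGen M k δ v = !![(-1 : ℚ) ^ k • gen M k v, inl M k V (δ v); 0, gen M k v] := rfl

theorem neg_one_pow_add_self (m : ℕ) : (-1 : ℚ) ^ (m + m) = 1 := by rw [← two_mul]; simp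

variable {M δ}

/-- This is the relation that `FreeGC.lift` requires. In the corner, moving `v` past `δ w` costs
`(-1)^(k (k+1))`, and together with the diagonal sign `(-1)^k` this is `(-1)^(k k)`. The two
summands of the corner trade places. -/
theorem matGen_comm (hδ : ∀ v, δ v ∈ M.deg (k + 1)) (v w : V) :
    matGen M k δ v * matGen M k δ w = (-1 : ℚ) ^ (k * k) • (matGen M k δ w * matGen M k δ v) := by
  have h1 := (T M k V).graded_comm (gen_mem M k v) (gen_mem M k w)
  have h2 := (T M k V).graded_comm (gen_mem M k v) (inl_mem M k (hδ w))
  have h3 := (T M k V).graded_comm (inl_mem M k (hδ v)) (gen_mem M k w)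
  rw [matGen_apply, matGen_apply, Matrix.mul_fin_two, Matrix.mul_fin_two]
  ext i j
  fin_cases i <;> fin_cases j
  · change (-1 : ℚ) ^ k • gen M k v * (-1 : ℚ) ^ k • gen M k w + inl M k V (δ v) * 0 =
      (-1 : ℚ) ^ (k * k) •
        ((-1 : ℚ) ^ k • gen M k w * (-1 : ℚ) ^ k • gen M k v + inl M k V (δ w) * 0)
    rw [smul_mul_smul_comm, smul_mul_smul_comm, h1, mul_zero, mul_zero, add_zero, add_zero,
      smul_comm]
  · change (-1 : ℚ) ^ k • gen M k v * inl M k V (δ w) + inl M k V (δ v) * gen M k w =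
      (-1 : ℚ) ^ (k * k) •
        ((-1 : ℚ) ^ k • gen M k w * inl M k V (δ v) + inl M k V (δ w) * gen M k v)
    rw [smul_mul_assoc, smul_mul_assoc, h2, h3, smul_add, smul_smul, smul_smul, ← pow_add,
      ← pow_add, add_comm, show k + k * (k + 1) = k * k + (k + k) by ring,
      pow_add _ _ (k + k), neg_one_pow_add_self, mul_one, add_mul, one_mul]
  · change 0 * (-1 : ℚ) ^ k • gen M k w + gen M k v * 0 =
      (-1 : ℚ) ^ (k * k) • (0 * (-1 : ℚ) ^ k • gen M k v + gen M k w * 0)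
    simp only [mul_zero, zero_mul, add_zero, smul_zero]
  · change 0 * inl M k V (δ w) + gen M k v * gen M k w =
      (-1 : ℚ) ^ (k * k) • (0 * inl M k V (δ v) + gen M k w * gen M k v)
    rw [zero_mul, zero_mul, zero_add, zero_add, h1]

/-- The algebra map on `Λ V` that encodes the differential. -/
noncomputable def matRight (hδ : ∀ v, δ v ∈ M.deg (k + 1)) :
    FreeGC k V →ₐ[ℚ] Matrix (Fin 2) (Fin 2) (T M k V).carrier :=
  FreeGC.lift k (matGen M k δ) (matGen_comm k hδ)

/-- The images of the two tensor factors commute up to the Koszul sign, as needed to map out of the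
graded tensor product. As for two generators, the corner summands are exchanged and the leftover
exponent is even. -/
theorem matLeft_mul_matGen (hδ : ∀ v, δ v ∈ M.deg (k + 1)) {i : ℕ} {a : M.carrier}
    (ha : a ∈ M.deg i) (v : V) :
    matLeft M k V a * matGen M k δ v = (-1 : ℚ) ^ (k * i) • (matGen M k δ v * matLeft M k V a) := by
  have h1 := (T M k V).graded_comm (inl_mem M k ha) (gen_mem M k v)
  have h2 := (T M k V).graded_comm (inl_mem M k ha) (inl_mem M k (hδ v))
  have h3 := (T M k V).graded_comm (inl_mem M k (M.d_mem ha)) (gen_mem M k v)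
  rw [matGen_apply, matLeft_apply, Matrix.mul_fin_two, Matrix.mul_fin_two]
  ext i j
  fin_cases i <;> fin_cases j
  · change inl M k V (M.sign a) * (-1 : ℚ) ^ k • gen M k v + inl M k V (M.d a) * 0 =
      (-1 : ℚ) ^ (k * i) •
        ((-1 : ℚ) ^ k • gen M k v * inl M k V (M.sign a) + inl M k V (δ v) * 0)
    rw [mul_zero, mul_zero, add_zero, add_zero, M.sign_of_mem ha, map_smul, smul_mul_smul_comm,
      smul_mul_smul_comm, h1, smul_smul, smul_smul, mul_comm i k]
    congr 1
    ring
  · change inl M k V (M.sign a) * inl M k V (δ v) + inl M k V (M.d a) * gen M k v =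
      (-1 : ℚ) ^ (k * i) •
        ((-1 : ℚ) ^ k • gen M k v * inl M k V (M.d a) + inl M k V (δ v) * inl M k V a)
    rw [M.sign_of_mem ha, map_smul, smul_mul_assoc, smul_mul_assoc, h2, h3, smul_add, smul_smul,
      smul_smul, ← pow_add, ← pow_add, add_comm,
      show i + i * (k + 1) = k * i + (i + i) by ring, show (i + 1) * k = k * i + k by ring,
      pow_add _ _ (i + i), neg_one_pow_add_self, mul_one]
  · change 0 * (-1 : ℚ) ^ k • gen M k v + inl M k V a * 0 =
      (-1 : ℚ) ^ (k * i) • (0 * inl M k V (M.sign a) + gen M k v * 0)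
    simp only [mul_zero, zero_mul, add_zero, smul_zero]
  · change 0 * inl M k V (δ v) + inl M k V a * gen M k v =
      (-1 : ℚ) ^ (k * i) • (0 * inl M k V (M.d a) + gen M k v * inl M k V a)
    rw [zero_mul, zero_mul, zero_add, zero_add, h1, mul_comm]

end Hirsch
-- Maps out of `M ⊗ Λ V` and the differential of `M⟨V⟩`.
namespace Hirsch

open GradedTensorProduct

theorem uzpow_smul {C : Type v} [AddCommGroup C] [Module ℚ C] (n : ℕ) (x : C) :
    (-1 : ℤˣ) ^ n • x = (-1 : ℚ) ^ n • x := by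
  rw [Units.smul_def, ← Int.cast_smul_eq_zsmul ℚ]
  congr 1
  have e := uzpow_natCast (R := ℕ) (-1) n
  rw [Nat.cast_id] at e
  rw [e]
  simp

variable {M : CDGA.{u}} (k : ℕ) {V : Type u} [AddCommGroup V] [Module ℚ V]

/-- Signs add up along a monomial, so graded commutation with all of `Λ V` only has to be checked on
generators. -/
theorem mul_comm_of_gen {C : Type v} [Ring C] [Algebra ℚ C] (f : M.carrier →ₐ[ℚ] C)
    (g : FreeGC k V →ₐ[ℚ] C)
    (h : ∀ i, ∀ a ∈ M.deg i, ∀ v, f a * g (FreeGC.ι k V v) =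
      (-1 : ℚ) ^ (k * i) • (g (FreeGC.ι k V v) * f a))
    {i j : ℕ} {a : M.carrier} (ha : a ∈ M.deg i) {b : FreeGC k V} (hb : b ∈ FreeGC.deg k V j) :
    f a * g b = (-1 : ℚ) ^ (j * i) • (g b * f a) := by
  refine FreeGC.deg_induction k
    (P := fun j b => f a * g b = (-1 : ℚ) ^ (j * i) • (g b * f a)) ?_ ?_ ?_ ?_ ?_ hb
  · simp
  · intro n x y hx hy
    rw [map_add, mul_add, hx, hy, add_mul, smul_add]
  · intro n r x hx
    rw [map_smul, mul_smul_comm, hx, smul_mul_assoc, smul_comm]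
  · simp
  · intro n x v _ hx
    rw [map_mul, ← mul_assoc, hx, smul_mul_assoc, mul_assoc, h i a ha, mul_smul_comm, smul_smul,
      ← pow_add, ← add_mul, mul_assoc]

/-- The algebra map out of `M ⊗ Λ V` determined by algebra maps on the factors. -/
noncomputable def lift {C : Type v} [Ring C] [Algebra ℚ C] (f : M.carrier →ₐ[ℚ] C)
    (g : FreeGC k V →ₐ[ℚ] C)
    (h : ∀ i, ∀ a ∈ M.deg i, ∀ v, f a * g (FreeGC.ι k V v) =
      (-1 : ℚ) ^ (k * i) • (g (FreeGC.ι k V v) * f a)) : (T M k V).carrier →ₐ[ℚ] C :=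
  GradedTensorProduct.lift M.deg (free k V).deg f (show (free k V).carrier →ₐ[ℚ] C from g)
    fun i j a b => by
      rw [uzpow_smul]
      exact mul_comm_of_gen k f g h a.2 b.2

theorem lift_inl {C : Type v} [Ring C] [Algebra ℚ C] (f : M.carrier →ₐ[ℚ] C)
    (g : FreeGC k V →ₐ[ℚ] C)
    (h : ∀ i, ∀ a ∈ M.deg i, ∀ v, f a * g (FreeGC.ι k V v) =
      (-1 : ℚ) ^ (k * i) • (g (FreeGC.ι k V v) * f a)) (a : M.carrier) :
    lift k f g h (inl M k V a) = f a := by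
  change f a * g 1 = f a
  rw [map_one, mul_one]

theorem lift_gen {C : Type v} [Ring C] [Algebra ℚ C] (f : M.carrier →ₐ[ℚ] C)
    (g : FreeGC k V →ₐ[ℚ] C)
    (h : ∀ i, ∀ a ∈ M.deg i, ∀ v, f a * g (FreeGC.ι k V v) =
      (-1 : ℚ) ^ (k * i) • (g (FreeGC.ι k V v) * f a)) (v : V) :
    lift k f g h (gen M k v) = g (FreeGC.ι k V v) := by
  change f 1 * g (FreeGC.ι k V v) = g (FreeGC.ι k V v)
  rw [map_one, one_mul]

theorem sign_inl (a : M.carrier) : (T M k V).sign (inl M k V a) = inl M k V (M.sign a) := by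
  refine M.induction_homogeneous
    (P := fun a => (T M k V).sign (inl M k V a) = inl M k V (M.sign a)) ?_ ?_ ?_ a
  · simp only [map_zero]
  · intro a b ha hb
    simp only [map_add, ha, hb]
  · intro n a ha
    rw [(T M k V).sign_of_mem (inl_mem M k ha), M.sign_of_mem ha, map_smul]

theorem sign_gen (v : V) : (T M k V).sign (gen M k v) = (-1 : ℚ) ^ k • gen M k v :=
  (T M k V).sign_of_mem (gen_mem M k v)

variable {δ : V →ₗ[ℚ] M.carrier} (hδ : ∀ v, δ v ∈ M.deg (k + 1))

/-- The algebra map `x ↦ (± x, d x; 0, x)` that encodes the differential of `M⟨V⟩`. -/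
noncomputable def mat : (T M k V).carrier →ₐ[ℚ] Matrix (Fin 2) (Fin 2) (T M k V).carrier :=
  lift k (matLeft M k V) (matRight k hδ) fun i a ha v => by
    have e : matRight k hδ (FreeGC.ι k V v) = matGen M k δ v := FreeGC.lift_ι k _ _ v
    rw [e]
    exact matLeft_mul_matGen k hδ ha v

theorem mat_inl (a : M.carrier) :
    mat k hδ (inl M k V a) = !![inl M k V (M.sign a), inl M k V (M.d a); 0, inl M k V a] :=
  lift_inl k _ _ _ a

theorem mat_gen (v : V) :
    mat k hδ (gen M k v) = !![(-1 : ℚ) ^ k • gen M k v, inl M k V (δ v); 0, gen M k v] :=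
  (lift_gen k _ _ _ v).trans (FreeGC.lift_ι k _ _ v)

/-- The differential of `M⟨V⟩`. -/
noncomputable def diff : (T M k V).carrier →ₗ[ℚ] (T M k V).carrier where
  toFun x := mat k hδ x 0 1
  map_add' x y := by rw [map_add, Matrix.add_apply]
  map_smul' r x := by rw [map_smul, Matrix.smul_apply, RingHom.id_apply]

/-- Only the corner entry is new information: the other three entries are multiplicative and are
determined by their values on `M` and `V`. -/
theorem mat_apply (x : (T M k V).carrier) :
    mat k hδ x = !![(T M k V).sign x, diff k hδ x; 0, x] := by
  suffices h : mat k hδ x 0 0 = (T M k V).sign x ∧ mat k hδ x 1 0 = 0 ∧ mat k hδ x 1 1 = x by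
    ext i j
    fin_cases i <;> fin_cases j
    · exact h.1
    · rfl
    · exact h.2.1
    · exact h.2.2
  refine induction M k (P := fun x => mat k hδ x 0 0 = (T M k V).sign x ∧ mat k hδ x 1 0 = 0 ∧
    mat k hδ x 1 1 = x) ?_ ?_ ?_ ?_ x
  · rintro x y ⟨h1, h2, h3⟩ ⟨h1', h2', h3'⟩
    rw [map_add, map_add, Matrix.add_apply, Matrix.add_apply, Matrix.add_apply, h1, h2, h3, h1',
      h2', h3', add_zero]
    exact ⟨rfl, rfl, rfl⟩
  · rintro r x ⟨h1, h2, h3⟩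
    rw [map_smul, map_smul, Matrix.smul_apply, Matrix.smul_apply, Matrix.smul_apply, h1, h2, h3,
      smul_zero]
    exact ⟨rfl, rfl, rfl⟩
  · intro a
    rw [mat_inl, sign_inl]
    exact ⟨rfl, rfl, rfl⟩
  · rintro x v ⟨h1, h2, h3⟩
    rw [map_mul, mat_gen, Matrix.mul_apply, Matrix.mul_apply, Matrix.mul_apply, Fin.sum_univ_two,
      Fin.sum_univ_two, Fin.sum_univ_two, h1, h2, h3, sign_mul, sign_gen]
    refine ⟨?_, ?_, ?_⟩
    · change _ + _ * 0 = _
      rw [mul_zero, add_zero]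
      rfl
    · change _ + _ * 0 = _
      rw [mul_zero, add_zero, zero_mul]
    · rw [zero_mul, zero_add]
      rfl

/-- Multiplicativity of `mat`, read in the corner entry. -/
theorem diff_mul (x y : (T M k V).carrier) :
    diff k hδ (x * y) = diff k hδ x * y + (T M k V).sign x * diff k hδ y := by
  have h := congrFun (congrFun (map_mul (mat k hδ) x y) 0) 1
  rw [Matrix.mul_apply, Fin.sum_univ_two] at h
  rw [mat_apply, mat_apply, mat_apply] at h
  exact h.trans (add_comm _ _)

theorem diff_inl (a : M.carrier) : diff k hδ (inl M k V a) = inl M k V (M.d a) := by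
  change mat k hδ (inl M k V a) 0 1 = _
  rw [mat_inl]
  rfl

theorem diff_gen (v : V) : diff k hδ (gen M k v) = inl M k V (δ v) := by
  change mat k hδ (gen M k v) 0 1 = _
  rw [mat_gen]
  rfl

theorem diff_mem {n : ℕ} {x : (T M k V).carrier} (hx : x ∈ (T M k V).deg n) :
    diff k hδ x ∈ (T M k V).deg (n + 1) := by
  refine deg_induction M k (P := fun n x => diff k hδ x ∈ (T M k V).deg (n + 1)) ?_ ?_ ?_ ?_ ?_ hx
  · intro n
    rw [map_zero]
    exact zero_mem _
  · intro n x y hx hy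
    rw [map_add]
    exact add_mem hx hy
  · intro n r x hx
    rw [map_smul]
    exact Submodule.smul_mem _ r hx
  · intro n a ha
    rw [diff_inl]
    exact inl_mem M k (M.d_mem ha)
  · intro n x hx v h
    rw [diff_mul, diff_gen]
    refine add_mem ?_ ?_
    · have := SetLike.mul_mem_graded h (gen_mem M k v)
      rwa [add_right_comm] at this
    · have := SetLike.mul_mem_graded ((T M k V).sign_mem hx) (inl_mem M k (V := V) (hδ v))
      rwa [← add_assoc] at this

theorem sign_diff (x : (T M k V).carrier) :
    (T M k V).sign (diff k hδ x) = -diff k hδ ((T M k V).sign x) := by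
  refine (T M k V).induction_homogeneous
    (P := fun x => (T M k V).sign (diff k hδ x) = -diff k hδ ((T M k V).sign x)) ?_ ?_ ?_ x
  · simp only [map_zero, neg_zero]
  · intro x y hx hy
    simp only [map_add, hx, hy, neg_add]
  · intro n x hx
    rw [(T M k V).sign_of_mem hx, (T M k V).sign_of_mem (diff_mem k hδ hx), map_smul, pow_succ,
      mul_neg_one, neg_smul]

/-- On a product `x v` the cross terms `± d x * δ v` cancel, because the sign involution
anticommutes with the differential. What remains is `d (d x) * v` and a multiple of `d (δ v)`, and
both vanish. -/
theorem diff_diff (hd : ∀ v, M.d (δ v) = 0) (x : (T M k V).carrier) :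
    diff k hδ (diff k hδ x) = 0 := by
  refine induction M k (P := fun x => diff k hδ (diff k hδ x) = 0) ?_ ?_ ?_ ?_ x
  · intro x y hx hy
    rw [map_add, map_add, hx, hy, add_zero]
  · intro r x hx
    rw [map_smul, map_smul, hx, smul_zero]
  · intro a
    rw [diff_inl, diff_inl, M.d_d, map_zero]
  · intro x v hx
    rw [diff_mul, map_add, diff_mul, diff_mul, hx, diff_gen, diff_inl, hd, sign_diff, map_zero,
      mul_zero, zero_mul, neg_mul, zero_add, add_zero, neg_add_cancel]

end Hirsch

/-- The CDGA `M⟨V⟩` obtained by adjoining generators `V` of degree `k` with differentials `δ`. -/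
noncomputable def hirsch (M : CDGA.{u}) (k : ℕ) {V : Type u} [AddCommGroup V] [Module ℚ V]
    (δ : V →ₗ[ℚ] M.carrier) (hδ : ∀ v, δ v ∈ M.deg (k + 1)) (hd : ∀ v, M.d (δ v) = 0) :
    CDGA.{u} where
  carrier := (Hirsch.T M k V).carrier
  deg := (Hirsch.T M k V).deg
  d := Hirsch.diff k hδ
  d_mem := Hirsch.diff_mem k hδ
  d_d := Hirsch.diff_diff k hδ hd
  leibniz hx y := by rw [Hirsch.diff_mul, (Hirsch.T M k V).sign_of_mem hx, smul_mul_assoc]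
  graded_comm := (Hirsch.T M k V).graded_comm

section

variable {M : CDGA.{u}} {k : ℕ} {V : Type u} [AddCommGroup V] [Module ℚ V]
  {δ : V →ₗ[ℚ] M.carrier} (hδ : ∀ v, δ v ∈ M.deg (k + 1)) (hd : ∀ v, M.d (δ v) = 0)

/-- The inclusion `M → M⟨V⟩`. -/
noncomputable def hirschIncl : Hom M (hirsch M k δ hδ hd) where
  toAlgHom := Hirsch.inl M k V
  map_deg := Hirsch.inl_mem M k
  map_d a := (Hirsch.diff_inl k hδ a).symm

/-- The generators of `M⟨V⟩`. -/
noncomputable def hirschGen : V →ₗ[ℚ] (hirsch M k δ hδ hd).carrier := Hirsch.gen M k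

theorem hirsch_deg_induction {P : ℕ → (hirsch M k δ hδ hd).carrier → Prop} (h0 : ∀ n, P n 0)
    (hadd : ∀ n x y, P n x → P n y → P n (x + y)) (hsmul : ∀ n (r : ℚ) x, P n x → P n (r • x))
    (hinl : ∀ n, ∀ a ∈ M.deg n, P n (hirschIncl hδ hd a))
    (hgen : ∀ n, ∀ x ∈ (hirsch M k δ hδ hd).deg n, ∀ v, P n x →
      P (n + k) (x * hirschGen hδ hd v))
    {n : ℕ} {x : (hirsch M k δ hδ hd).carrier} (hx : x ∈ (hirsch M k δ hδ hd).deg n) : P n x :=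
  Hirsch.deg_induction M k (P := P) h0 hadd hsmul hinl hgen hx

theorem hirsch_induction {P : (hirsch M k δ hδ hd).carrier → Prop}
    (hadd : ∀ x y, P x → P y → P (x + y)) (hsmul : ∀ (r : ℚ) x, P x → P (r • x))
    (hinl : ∀ a, P (hirschIncl hδ hd a)) (hgen : ∀ x v, P x → P (x * hirschGen hδ hd v))
    (x : (hirsch M k δ hδ hd).carrier) : P x :=
  Hirsch.induction M k (P := P) hadd hsmul hinl hgen x

end

theorem Hom.ext {A : CDGA.{u}} {B : CDGA.{v}} {f g : Hom A B} (h : ∀ a, f a = g a) : f = g := by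
  obtain ⟨f, _, _⟩ := f
  obtain ⟨g, _, _⟩ := g
  obtain rfl : f = g := AlgHom.ext h
  rfl

/-! ### The universal property of `M⟨V⟩`. -/

section

variable {M : CDGA.{u}} {k : ℕ} {V : Type u} [AddCommGroup V] [Module ℚ V]
  {δ : V →ₗ[ℚ] M.carrier} (hδ : ∀ v, δ v ∈ M.deg (k + 1)) (hd : ∀ v, M.d (δ v) = 0)

/-- Graded commutativity of `C` supplies the relations on `Λ V` and between the two factors, so the
algebra map always exists. The condition on `θ` makes it commute with `d` on generators, and the
Leibniz rule propagates this to monomials. -/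
theorem hirsch_existsUnique (C : CDGA.{u}) (φ : Hom M C) (θ : V →ₗ[ℚ] C.carrier)
    (hθ : ∀ v, θ v ∈ C.deg k) (hθd : ∀ v, C.d (θ v) = φ (δ v)) :
    ∃! ψ : Hom (hirsch M k δ hδ hd) C, (∀ x, ψ (hirschIncl hδ hd x) = φ x) ∧
      ∀ v, ψ (hirschGen hδ hd v) = θ v := by
  let g : FreeGC k V →ₐ[ℚ] C.carrier :=
    FreeGC.lift k θ fun v w => C.graded_comm (hθ v) (hθ w)
  have hg : ∀ v, g (FreeGC.ι k V v) = θ v := fun v => FreeGC.lift_ι k _ _ v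
  have hfg : ∀ i, ∀ a ∈ M.deg i, ∀ v, φ.toAlgHom a * g (FreeGC.ι k V v) =
      (-1 : ℚ) ^ (k * i) • (g (FreeGC.ι k V v) * φ.toAlgHom a) := by
    intro i a ha v
    rw [hg, mul_comm k i]
    exact C.graded_comm (φ.map_deg ha) (hθ v)
  let F : (hirsch M k δ hδ hd).carrier →ₐ[ℚ] C.carrier := Hirsch.lift k φ.toAlgHom g hfg
  have Fl : ∀ a, F (hirschIncl hδ hd a) = φ a := fun a => Hirsch.lift_inl k φ.toAlgHom g hfg a
  have Fg : ∀ v, F (hirschGen hδ hd v) = θ v := fun v =>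
    (Hirsch.lift_gen k φ.toAlgHom g hfg v).trans (hg v)
  have Fdeg : ∀ {n : ℕ} {x : (hirsch M k δ hδ hd).carrier}, x ∈ (hirsch M k δ hδ hd).deg n →
      F x ∈ C.deg n := by
    intro n x hx
    refine hirsch_deg_induction hδ hd (P := fun n x => F x ∈ C.deg n) ?_ ?_ ?_ ?_ ?_ hx
    · intro n
      rw [map_zero]
      exact zero_mem _
    · intro n x y hx hy
      rw [map_add]
      exact add_mem hx hy
    · intro n r x hx
      rw [map_smul]
      exact Submodule.smul_mem _ r hx
    · intro n a ha
      rw [Fl]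
      exact φ.map_deg ha
    · intro n x _ v hx
      rw [map_mul, Fg]
      exact SetLike.mul_mem_graded hx (hθ v)
  -- The Leibniz rule in the form `d_mul` involves the sign involution, so compatibility with it is
  -- needed before compatibility with `d`.
  have Fsign : ∀ x, F ((hirsch M k δ hδ hd).sign x) = C.sign (F x) := by
    intro x
    refine (hirsch M k δ hδ hd).induction_homogeneous
      (P := fun x => F ((hirsch M k δ hδ hd).sign x) = C.sign (F x)) ?_ ?_ ?_ x
    · simp only [map_zero]
    · intro x y hx hy
      simp only [map_add, hx, hy]
    · intro n x hx
      rw [sign_of_mem _ hx, map_smul, sign_of_mem _ (Fdeg hx)]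
  have Fd : ∀ x, F ((hirsch M k δ hδ hd).d x) = C.d (F x) := by
    intro x
    refine hirsch_induction hδ hd
      (P := fun x => F ((hirsch M k δ hδ hd).d x) = C.d (F x)) ?_ ?_ ?_ ?_ x
    · intro x y hx hy
      rw [map_add, map_add, map_add, map_add, hx, hy]
    · intro r x hx
      rw [map_smul, map_smul, map_smul, map_smul, hx]
    · intro a
      rw [← (hirschIncl hδ hd).map_d, Fl, Fl, φ.map_d]
    · intro x v hx
      have e : (hirsch M k δ hδ hd).d (hirschGen hδ hd v) = hirschIncl hδ hd (δ v) :=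
        Hirsch.diff_gen k hδ v
      rw [d_mul, map_add, map_mul, map_mul, map_mul, d_mul, e, Fl, Fg, hx, Fsign, hθd]
  refine ⟨⟨F, Fdeg, Fd⟩, ⟨Fl, Fg⟩, ?_⟩
  rintro ψ ⟨h1, h2⟩
  refine Hom.ext fun x => ?_
  change ψ x = F x
  refine hirsch_induction hδ hd (P := fun x => ψ x = F x) ?_ ?_ ?_ ?_ x
  · intro x y hx hy
    rw [map_add, map_add, hx, hy]
  · intro r x hx
    rw [map_smul, map_smul, hx]
  · intro a
    rw [h1, Fl]
  · intro x v hx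
    rw [map_mul, map_mul, hx, h2, Fg]

/-- `M → M⟨V⟩` is a Hirsch extension. -/
noncomputable def hirschExtension : HirschExtension k V M (hirsch M k δ hδ hd) where
  incl := hirschIncl hδ hd
  attach := δ
  gen := hirschGen hδ hd
  attach_mem := hδ
  d_attach := hd
  gen_mem := Hirsch.gen_mem M k
  d_gen := Hirsch.diff_gen k hδ
  isPushout := hirsch_existsUnique hδ hd

end

/-! ### Homogeneous lifts, and induction in an arbitrary Hirsch extension. -/

theorem Hom.map_proj {A : CDGA.{u}} {B : CDGA.{v}} (f : Hom A B) (n : ℕ) (a : A.carrier) :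
    f (A.proj n a) = B.proj n (f a) := by
  refine A.induction_homogeneous (P := fun a => f (A.proj n a) = B.proj n (f a)) ?_ ?_ ?_ a
  · simp only [map_zero]
  · intro a b ha hb
    simp only [map_add, ha, hb]
  · intro m a ha
    by_cases hmn : m = n
    · subst hmn
      rw [proj_same _ ha, proj_same _ (f.map_deg ha)]
    · rw [proj_ne _ hmn ha, proj_ne _ hmn (f.map_deg ha), map_zero]

theorem proj_mem (A : CDGA.{u}) (n : ℕ) (a : A.carrier) : A.proj n a ∈ A.deg n :=
  (DirectSum.decompose A.deg a n).2

/-- Homogeneous elements of the target of a surjective map lift to homogeneous elements. -/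
theorem Hom.exists_of_mem_deg {A : CDGA.{u}} {B : CDGA.{v}} (f : Hom A B)
    (hf : Function.Surjective f) {n : ℕ} {b : B.carrier} (hb : b ∈ B.deg n) :
    ∃ a ∈ A.deg n, f a = b := by
  obtain ⟨a, rfl⟩ := hf b
  exact ⟨A.proj n a, A.proj_mem n a, by rw [f.map_proj, proj_same _ hb]⟩

theorem Hom.map_decomposable {M N : CDGA.{u}} (g : Hom M N) {x : M.carrier}
    (hx : x ∈ M.augIdeal * M.augIdeal) : g x ∈ N.augIdeal * N.augIdeal := by
  refine Submodule.mul_induction_on (C := fun x => g x ∈ N.augIdeal * N.augIdeal) hx ?_ ?_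
  · intro a ha b hb
    rw [map_mul]
    exact Submodule.mul_mem_mul (g.map_augIdeal ha) (g.map_augIdeal hb)
  · intro a b ha hb
    rw [map_add]
    exact add_mem ha hb

namespace HirschExtension

variable {M M' : CDGA.{u}} {k : ℕ} {V : Type u} [AddCommGroup V] [Module ℚ V]

/-- Both maps solve the pushout problem posed by the restrictions of `g`, and that solution is
unique. -/
theorem hom_ext (E : HirschExtension k V M M') {C : CDGA.{u}} {f g : Hom M' C}
    (h1 : ∀ x, f (E.incl x) = g (E.incl x)) (h2 : ∀ v, f (E.gen v) = g (E.gen v)) : f = g := by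
  obtain ⟨ψ, -, hψ⟩ := E.isPushout C (g.comp E.incl) (g.toAlgHom.toLinearMap ∘ₗ E.gen)
    (fun v => g.map_deg (E.gen_mem v)) (fun v => by
      have := g.map_d (E.gen v)
      rw [E.d_gen] at this
      exact this.symm)
  rw [hψ f ⟨h1, h2⟩, hψ g ⟨fun _ => rfl, fun _ => rfl⟩]

/-- Induction over the monomials `a v_1 ⋯ v_l`, in each degree. -/
theorem deg_induction (E : HirschExtension k V M M') {P : ℕ → M'.carrier → Prop}
    (h0 : ∀ n, P n 0)
    (hadd : ∀ n x y, P n x → P n y → P n (x + y)) (hsmul : ∀ n (r : ℚ) x, P n x → P n (r • x))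
    (hincl : ∀ n, ∀ a ∈ M.deg n, P n (E.incl a))
    (hgen : ∀ n, ∀ x ∈ M'.deg n, ∀ v, P n x → P (n + k) (x * E.gen v))
    {n : ℕ} {x : M'.carrier} (hx : x ∈ M'.deg n) : P n x := by
  -- An abstract Hirsch extension is compared with the explicit one. The two universal properties
  -- give maps in both directions, and `φ ∘ ψ = id` by uniqueness. Hence `φ` is surjective, and
  -- induction in the explicit model transfers along it.
  obtain ⟨φ, ⟨h1, h2⟩, -⟩ := hirsch_existsUnique E.attach_mem E.d_attach M' E.incl E.gen E.gen_mem
    E.d_gen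
  let E' := hirschExtension E.attach_mem E.d_attach
  obtain ⟨ψ, ⟨h1', h2'⟩, -⟩ := E.isPushout _ E'.incl E'.gen E'.gen_mem E'.d_gen
  have h : φ.comp ψ = ⟨AlgHom.id ℚ _, fun h => h, fun _ => rfl⟩ := by
    refine E.hom_ext (fun x => ?_) (fun v => ?_)
    · change φ (ψ (E.incl x)) = E.incl x
      rw [h1']
      exact h1 x
    · change φ (ψ (E.gen v)) = E.gen v
      rw [h2']
      exact h2 v
  have hs : Function.Surjective φ := fun y => ⟨ψ y, congrArg (fun f : Hom M' M' => f y) h⟩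
  obtain ⟨y, hy, rfl⟩ := φ.exists_of_mem_deg hs hx
  refine hirsch_deg_induction E.attach_mem E.d_attach (P := fun n y => P n (φ y)) ?_ ?_ ?_ ?_ ?_ hy
  · intro n
    rw [map_zero]
    exact h0 n
  · intro n x y hx hy
    rw [map_add]
    exact hadd n _ _ hx hy
  · intro n r x hx
    rw [map_smul]
    exact hsmul n r _ hx
  · intro n a ha
    rw [h1]
    exact hincl n a ha
  · intro n x hx v h
    rw [map_mul, h2]
    exact hgen n _ (φ.map_deg hx) v h

end HirschExtension

/-! ### Low degrees and decomposables of minimal algebras. -/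

/-- What is used of the shape of a `k`-minimal algebra. -/
theorem IsMinimalAlgebra.shape {k : ℕ} {M : CDGA.{u}} (h : IsMinimalAlgebra k M) :
    (∀ x ∈ M.deg 0, ∃ q : ℚ, x = algebraMap ℚ _ q) ∧ (∀ x ∈ M.deg 1, M.d x = 0) ∧
      (∀ n, k < n → ∀ x ∈ M.deg n, x ∈ M.augIdeal * M.augIdeal) ∧
      (k = 0 → ∀ n, 0 < n → ∀ x ∈ M.deg n, x = 0) := by
  induction h with
  | base M h =>
    have h0 : ∀ n, 0 < n → ∀ x ∈ M.deg n, x = 0 := by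
      intro n hn x hx
      obtain ⟨q, rfl⟩ := h.2 x
      rw [← M.proj_same hx]
      exact M.proj_ne hn.ne (SetLike.algebraMap_mem_graded M.deg q)
    refine ⟨fun x _ => ?_, fun x hx => ?_, fun n hn x hx => ?_, fun _ => h0⟩
    · obtain ⟨q, rfl⟩ := h.2 x
      exact ⟨q, rfl⟩
    · rw [h0 1 one_pos x hx, map_zero]
    · rw [h0 n hn x hx]
      exact zero_mem _
  | @step k M M' V _ _ E h ih =>
    obtain ⟨i0, i1, i2, i3⟩ := ih
    have key : ∀ {n x}, x ∈ M'.deg n → (n = 0 → ∃ q : ℚ, x = algebraMap ℚ _ q) ∧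
        (n = 1 → M'.d x = 0) ∧ (k + 1 < n → x ∈ M'.augIdeal * M'.augIdeal) := by
      intro n x hx
      refine E.deg_induction (P := fun n x => (n = 0 → ∃ q : ℚ, x = algebraMap ℚ _ q) ∧
        (n = 1 → M'.d x = 0) ∧ (k + 1 < n → x ∈ M'.augIdeal * M'.augIdeal)) ?_ ?_ ?_ ?_ ?_ hx
      · exact fun n => ⟨fun _ => ⟨0, by simp⟩, fun _ => map_zero _, fun _ => zero_mem _⟩
      · rintro n x y ⟨h1, h2, h3⟩ ⟨h1', h2', h3'⟩
        refine ⟨fun h => ?_, fun h => ?_, fun h => add_mem (h3 h) (h3' h)⟩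
        · obtain ⟨q, rfl⟩ := h1 h
          obtain ⟨q', rfl⟩ := h1' h
          exact ⟨q + q', by simp⟩
        · rw [map_add, h2 h, h2' h, add_zero]
      · rintro n r x ⟨h1, h2, h3⟩
        refine ⟨fun h => ?_, fun h => ?_, fun h => Submodule.smul_mem _ r (h3 h)⟩
        · obtain ⟨q, rfl⟩ := h1 h
          exact ⟨r * q, by rw [map_mul, Algebra.smul_def]⟩
        · rw [map_smul, h2 h, smul_zero]
      · intro n a ha
        refine ⟨?_, ?_, ?_⟩
        · rintro rfl
          obtain ⟨q, rfl⟩ := i0 a ha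
          exact ⟨q, E.incl.toAlgHom.commutes q⟩
        · rintro rfl
          rw [← E.incl.map_d, i1 a ha, map_zero]
        · intro h
          exact E.incl.map_decomposable (i2 n (by omega) a ha)
      · rintro n x hx v ⟨h1, h2, h3⟩
        refine ⟨fun h => by omega, fun h => ?_, fun h => ?_⟩
        -- A monomial `x v` of degree `1` forces `x` to be a scalar and `k = 0`. Then `d v` lies in
        -- degree `2` of `M_0 = ℚ`, which is zero; the last clause of the invariant exists for this
        -- case.
        · obtain ⟨q, rfl⟩ := h1 (by omega)
          obtain rfl : k = 0 := by omega
          rw [← Algebra.smul_def, map_smul, E.d_gen, i3 rfl 2 two_pos _ (E.attach_mem v), map_zero,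
            smul_zero]
        -- As `v` has degree `k + 1` and the product has larger degree, `x` also has positive
        -- degree.
        · exact Submodule.mul_mem_mul (M'.mem_augIdeal (by omega) hx)
            (M'.mem_augIdeal (by omega) (E.gen_mem v))
    exact ⟨fun x hx => (key hx).1 rfl, fun x hx => (key hx).2.1 rfl,
      fun n hn x hx => (key hx).2.2 hn, fun h => absurd h k.succ_ne_zero⟩

theorem d_proj (A : CDGA.{u}) (n : ℕ) (a : A.carrier) :
    A.d (A.proj n a) = A.proj (n + 1) (A.d a) := by
  refine A.induction_homogeneous
    (P := fun a => A.d (A.proj n a) = A.proj (n + 1) (A.d a)) ?_ ?_ ?_ a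
  · simp only [map_zero]
  · intro a b ha hb
    simp only [map_add, ha, hb]
  · intro m a ha
    by_cases hmn : m = n
    · subst hmn
      rw [proj_same _ ha, proj_same _ (A.d_mem ha)]
    · rw [proj_ne _ hmn ha, proj_ne _ (by omega) (A.d_mem ha), map_zero]

/-- An augmentation of an algebra with `M^0 = ℚ`. -/
theorem exists_augmentation {M : CDGA.{u}} (hinj : Function.Injective (algebraMap ℚ M.carrier))
    (h0 : ∀ x ∈ M.deg 0, ∃ q : ℚ, x = algebraMap ℚ _ q) :
    ∃ η : M.carrier →ₐ[ℚ] ℚ, ∀ n, 0 < n → ∀ a ∈ M.deg n, η a = 0 := by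
  -- The augmentation takes the scalar `q a` with `q a • 1` the degree `0` part of `a`; injectivity
  -- of `ℚ → M` makes `q` a ring map.
  choose q hq using fun a : M.carrier => h0 _ (M.proj_mem 0 a)
  have hmul : ∀ a b, M.proj 0 (a * b) = M.proj 0 a * M.proj 0 b :=
    map_mul (GradedRing.projZeroRingHom M.deg)
  let η : M.carrier →+* ℚ :=
    { toFun := q
      map_one' := hinj (by rw [← hq, M.proj_same M.one_mem, map_one])
      map_mul' := fun a b => hinj (by rw [← hq, hmul, map_mul, ← hq, ← hq])
      map_zero' := hinj (by rw [← hq, map_zero, map_zero])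
      map_add' := fun a b => hinj (by rw [← hq, map_add, map_add, ← hq, ← hq]) }
  refine ⟨η.toRatAlgHom, fun n hn a ha => hinj ?_⟩
  change algebraMap ℚ M.carrier (q a) = _
  rw [← hq, map_zero, M.proj_ne hn.ne' ha]

/-! ### Indecomposables and low degrees of `M⟨V⟩`. -/

section

variable {M : CDGA.{u}} {k : ℕ} {V : Type u} [AddCommGroup V] [Module ℚ V]
  {δ : V →ₗ[ℚ] M.carrier} (hδ : ∀ v, δ v ∈ M.deg (k + 1)) (hd : ∀ v, M.d (δ v) = 0)

/-- Sending `V` to zero is a retraction onto `M`. It need not respect the differential, and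
injectivity does not require that. -/
theorem hirschIncl_injective : Function.Injective (hirschIncl hδ hd) := by
  let g : FreeGC k V →ₐ[ℚ] M.carrier := FreeGC.lift k 0 (by simp)
  have hg : ∀ v, g (FreeGC.ι k V v) = 0 := fun v => FreeGC.lift_ι k _ _ v
  let R := Hirsch.lift k (AlgHom.id ℚ M.carrier) g fun i a _ v => by simp [hg]
  exact Function.LeftInverse.injective (g := R) fun a => Hirsch.lift_inl k _ _ _ a

/-- The augmentation on `M` and the inclusion of `V` combine to an algebra map from `M⟨V⟩` to the
square-zero extension `ℚ ⊕ V`. It takes positive degrees into `V`, hence kills decomposables, but it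
sends the generator `v` to `v`. The differential plays no role. -/
theorem eq_zero_of_hirschGen_mem
    (hinj : Function.Injective (algebraMap ℚ M.carrier))
    (h0 : ∀ x ∈ M.deg 0, ∃ q : ℚ, x = algebraMap ℚ _ q) (v : V)
    (hv : hirschGen hδ hd v ∈
      (hirsch M k δ hδ hd).augIdeal * (hirsch M k δ hδ hd).augIdeal) : v = 0 := by
  obtain ⟨η, hη⟩ := exists_augmentation hinj h0
  -- The multiplication of a square-zero extension uses a right action as well, here made equal to
  -- the left one.
  let _ : Module ℚᵐᵒᵖ V := Module.compHom _ ((RingHom.id ℚ).fromOpposite mul_comm)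
  have _ : IsCentralScalar ℚ V := ⟨fun _ _ => rfl⟩
  let g : FreeGC k V →ₐ[ℚ] TrivSqZeroExt ℚ V :=
    FreeGC.lift k (TrivSqZeroExt.inrHom ℚ V) (by simp)
  have hg : ∀ v, g (FreeGC.ι k V v) = TrivSqZeroExt.inr v := fun v => FreeGC.lift_ι k _ _ v
  let f : M.carrier →ₐ[ℚ] TrivSqZeroExt ℚ V := (TrivSqZeroExt.inlAlgHom ℚ ℚ V).comp η
  have hf : ∀ a, f a = TrivSqZeroExt.inl (η a) := fun _ => rfl
  have hfg : ∀ i, ∀ a ∈ M.deg i, ∀ v, f a * g (FreeGC.ι k V v) =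
      (-1 : ℚ) ^ (k * i) • (g (FreeGC.ι k V v) * f a) := by
    intro i a ha v
    -- The target is commutative without signs. This is harmless: for `i = 0` the sign is trivial,
    -- and for `i > 0` the element `a` is sent to zero.
    rcases Nat.eq_zero_or_pos i with rfl | hi
    · rw [mul_zero, pow_zero, one_smul, mul_comm]
    · rw [hf, hη i hi a ha, TrivSqZeroExt.inl_zero, zero_mul, mul_zero, smul_zero]
  let F : (hirsch M k δ hδ hd).carrier →ₐ[ℚ] TrivSqZeroExt ℚ V := Hirsch.lift k f g hfg
  have Fl : ∀ a, F (hirschIncl hδ hd a) = TrivSqZeroExt.inl (η a) :=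
    fun a => Hirsch.lift_inl k f g hfg a
  have Fg : ∀ v, F (hirschGen hδ hd v) = TrivSqZeroExt.inr v := fun v =>
    (Hirsch.lift_gen k f g hfg v).trans (hg v)
  have Fpos : ∀ x ∈ (hirsch M k δ hδ hd).augIdeal, (F x).fst = 0 := by
    have : (hirsch M k δ hδ hd).augIdeal ≤
        LinearMap.ker ((TrivSqZeroExt.fstHom ℚ ℚ V).comp F).toLinearMap := by
      refine iSup_le fun n x hx => ?_
      refine hirsch_deg_induction hδ hd (P := fun n x => 0 < n → (F x).fst = 0)
        ?_ ?_ ?_ ?_ ?_ hx n.succ_pos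
      · intro n _
        rw [map_zero, TrivSqZeroExt.fst_zero]
      · intro n x y hx hy hn
        rw [map_add, TrivSqZeroExt.fst_add, hx hn, hy hn, add_zero]
      · intro n r x hx hn
        rw [map_smul, TrivSqZeroExt.fst_smul, hx hn, smul_zero]
      · intro n a ha hn
        rw [Fl, hη n hn a ha, TrivSqZeroExt.fst_inl]
      · intro n x _ v _ _
        rw [map_mul, TrivSqZeroExt.fst_mul, Fg, TrivSqZeroExt.fst_inr, mul_zero]
    exact fun x hx => this hx
  have h : F (hirschGen hδ hd v) = 0 := by
    refine Submodule.mul_induction_on (C := fun x => F x = 0) hv ?_ ?_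
    · intro a ha b hb
      rw [map_mul]
      ext
      · rw [TrivSqZeroExt.fst_mul, Fpos a ha, zero_mul, TrivSqZeroExt.fst_zero]
      · rw [TrivSqZeroExt.snd_mul, Fpos a ha, Fpos b hb]
        simp
    · intro a b ha hb
      rw [map_add, ha, hb, add_zero]
  rw [Fg] at h
  exact TrivSqZeroExt.inr_injective (h.trans (TrivSqZeroExt.inr_zero ℚ).symm)

/-- The elements of `M⟨V⟩` of low degree. -/
theorem hirsch_deg_cases (hk : 0 < k) (h0 : ∀ x ∈ M.deg 0, ∃ q : ℚ, x = algebraMap ℚ _ q)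
    {n : ℕ} {x : (hirsch M k δ hδ hd).carrier} (hx : x ∈ (hirsch M k δ hδ hd).deg n) :
    (n < k → ∃ a ∈ M.deg n, x = hirschIncl hδ hd a) ∧
    (n = k → ∃ a ∈ M.deg n, ∃ v, x = hirschIncl hδ hd a + hirschGen hδ hd v) ∧
    (2 ≤ k → (∀ a ∈ M.deg 1, a = 0) → n = k + 1 → ∃ a ∈ M.deg n, x = hirschIncl hδ hd a) := by
  refine hirsch_deg_induction hδ hd (P := fun n x =>
    (n < k → ∃ a ∈ M.deg n, x = hirschIncl hδ hd a) ∧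
    (n = k → ∃ a ∈ M.deg n, ∃ v, x = hirschIncl hδ hd a + hirschGen hδ hd v) ∧
    (2 ≤ k → (∀ a ∈ M.deg 1, a = 0) → n = k + 1 → ∃ a ∈ M.deg n, x = hirschIncl hδ hd a))
    ?_ ?_ ?_ ?_ ?_ hx
  · exact fun n => ⟨fun _ => ⟨0, zero_mem _, (map_zero _).symm⟩,
      fun _ => ⟨0, zero_mem _, 0, by simp⟩, fun _ _ _ => ⟨0, zero_mem _, (map_zero _).symm⟩⟩
  · rintro n x y ⟨h1, h2, h3⟩ ⟨h1', h2', h3'⟩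
    refine ⟨fun h => ?_, fun h => ?_, fun h h' h'' => ?_⟩
    · obtain ⟨a, ha, rfl⟩ := h1 h
      obtain ⟨b, hb, rfl⟩ := h1' h
      exact ⟨a + b, add_mem ha hb, (map_add _ _ _).symm⟩
    · obtain ⟨a, ha, v, rfl⟩ := h2 h
      obtain ⟨b, hb, w, rfl⟩ := h2' h
      exact ⟨a + b, add_mem ha hb, v + w, by rw [map_add, map_add]; abel⟩
    · obtain ⟨a, ha, rfl⟩ := h3 h h' h''
      obtain ⟨b, hb, rfl⟩ := h3' h h' h''
      exact ⟨a + b, add_mem ha hb, (map_add _ _ _).symm⟩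
  · rintro n r x ⟨h1, h2, h3⟩
    refine ⟨fun h => ?_, fun h => ?_, fun h h' h'' => ?_⟩
    · obtain ⟨a, ha, rfl⟩ := h1 h
      exact ⟨r • a, Submodule.smul_mem _ r ha, (map_smul _ _ _).symm⟩
    · obtain ⟨a, ha, v, rfl⟩ := h2 h
      exact ⟨r • a, Submodule.smul_mem _ r ha, r • v, by rw [map_smul, map_smul, smul_add]⟩
    · obtain ⟨a, ha, rfl⟩ := h3 h h' h''
      exact ⟨r • a, Submodule.smul_mem _ r ha, (map_smul _ _ _).symm⟩
  · exact fun n a ha => ⟨fun _ => ⟨a, ha, rfl⟩, fun _ => ⟨a, ha, 0, by simp⟩,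
      fun _ _ _ => ⟨a, ha, rfl⟩⟩
  -- In degree at most `k + 1` the cofactor `x` of `v` has degree `0` or `1`. It is then a scalar,
  -- or an element of `M^1 = 0` because `1 < k`.
  · rintro n x - v ⟨h1, -, -⟩
    refine ⟨fun h => by omega, fun h => ?_, fun h h' h'' => ?_⟩
    · obtain rfl : n = 0 := by omega
      obtain ⟨a, ha, rfl⟩ := h1 hk
      obtain ⟨q, rfl⟩ := h0 a ha
      refine ⟨0, zero_mem _, q • v, ?_⟩
      rw [map_zero, zero_add, map_smul, Algebra.smul_def]
      congr 1
    · obtain rfl : n = 1 := by omega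
      obtain ⟨a, ha, rfl⟩ := h1 h
      exact ⟨0, zero_mem _, by rw [h' a ha, map_zero, zero_mul]⟩

/-- The degree `k` part of `M⟨V⟩` is `M^k + V`. The summand `M^k` dies in the indecomposables, and
`V` survives by `eq_zero_of_hirschGen_mem`. -/
theorem hirschExtension_toQ_bijective (hk : 0 < k)
    (hinj : Function.Injective (algebraMap ℚ M.carrier))
    (h0 : ∀ x ∈ M.deg 0, ∃ q : ℚ, x = algebraMap ℚ _ q)
    (hQ : ∀ x ∈ M.deg k, x ∈ M.augIdeal * M.augIdeal) :
    Function.Bijective (hirschExtension hδ hd).toQ := by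
  constructor
  · rw [← LinearMap.ker_eq_bot, LinearMap.ker_eq_bot']
    intro v hv
    exact eq_zero_of_hirschGen_mem hδ hd hinj h0 v
      ((Submodule.Quotient.mk_eq_zero
        (((hirsch M k δ hδ hd).augIdeal * (hirsch M k δ hδ hd).augIdeal).submoduleOf
          ((hirsch M k δ hδ hd).deg k))).1 hv)
  · intro z
    obtain ⟨⟨x, hx⟩, rfl⟩ := Submodule.mkQ_surjective _ z
    obtain ⟨a, ha, v, rfl⟩ := (hirsch_deg_cases hδ hd hk h0 hx).2.1 rfl
    refine ⟨v, (Submodule.Quotient.eq _).2 ?_⟩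
    change hirschGen hδ hd v - (hirschIncl hδ hd a + hirschGen hδ hd v) ∈
      (hirsch M k δ hδ hd).augIdeal * (hirsch M k δ hδ hd).augIdeal
    rw [sub_add_cancel_right]
    exact neg_mem ((hirschIncl hδ hd).map_decomposable (hQ a ha))

end

/-! ### The cylinder -/

section Cylinder

theorem derivative_antiderivative (p : ℚ[X]) :
    Polynomial.derivative (antiderivative p) = p := by
  induction p using Polynomial.induction_on' with
  | add p q hp hq => rw [map_add, map_add, hp, hq]
  | monomial n a =>
    have h : (n : ℚ) + 1 ≠ 0 := by positivity
    rw [antiderivative_monomial, Polynomial.derivative_monomial]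
    simp [h]

/-- The fundamental theorem of calculus, used twice: differentiating an integral gives the form
part, integrating a derivative gives the function part up to its value at `0`. -/
theorem intervalD_intervalIntegral (ω : IntervalCarrier) :
    intervalD (intervalIntegral ω) + intervalIntegral (intervalD ω) =
      ω - intervalEval 0 ω • (1 : IntervalCarrier) := by
  change TrivSqZeroExt.inr (Polynomial.derivative (antiderivative ω.snd)) +
    TrivSqZeroExt.inl (antiderivative (Polynomial.derivative ω.fst)) =
      ω - Polynomial.aeval (0 : ℚ) ω.fst • (1 : IntervalCarrier)
  rw [derivative_antiderivative, antiderivative_derivative]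
  ext1
  · simp [Polynomial.coe_aeval_eq_eval, Polynomial.smul_eq_C_mul]
  · simp

variable (B : CDGA.{u})

theorem cylTmul_mul_cylTmul {i j : ℕ} (b b' : B.carrier) {ω : IntervalCarrier}
    (hω : ω ∈ intervalDeg j) (hb' : b' ∈ B.deg i) (ω' : IntervalCarrier) :
    (cylTmul b ω * cylTmul b' ω' : B.cylinder.carrier) =
      (-1 : ℚ) ^ (j * i) • cylTmul (b * b') (ω * ω') :=
  tmul_mul_tmul B intervalForms b hω hb' ω'

theorem cylTmul_mem {i j : ℕ} {b : B.carrier} {ω : IntervalCarrier} (hb : b ∈ B.deg i)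
    (hω : ω ∈ intervalDeg j) : cylTmul b ω ∈ B.cylinder.deg (i + j) :=
  tmul_mem_tensorDeg B intervalForms hb hω

theorem intervalEval_eq_zero (s : ℚ) {j : ℕ} (hj : 0 < j) {ω : IntervalCarrier}
    (hω : ω ∈ intervalDeg j) : intervalEval s ω = 0 := by
  rcases mem_intervalDeg_cases hω with ⟨rfl, p, rfl⟩ | ⟨rfl, q, rfl⟩ | rfl
  · omega
  · simp [intervalEval]
  · exact map_zero _

/-- The Koszul sign of the cylinder matters only when the form crossing `b'` has positive degree,
and then both sides evaluate to zero. -/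
theorem evalAt_mul (s : ℚ) (x y : B.cylinder.carrier) :
    B.evalAt s (x * y) = B.evalAt s x * B.evalAt s y := by
  refine B.cylinder_induction
    (P := fun x => B.evalAt s (x * y) = B.evalAt s x * B.evalAt s y) ?_ ?_ ?_ ?_ x
  · rw [zero_mul, map_zero, zero_mul]
  · intro x x' hx hx'
    rw [add_mul, map_add, map_add, hx, hx', add_mul]
  · intro r x hx
    rw [smul_mul_assoc, map_smul, map_smul, hx, smul_mul_assoc]
  intro i j b hb ω hω
  refine B.cylinder_induction
    (P := fun y => B.evalAt s (cylTmul b ω * y) = B.evalAt s (cylTmul b ω) * B.evalAt s y)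
    ?_ ?_ ?_ ?_ y
  · rw [mul_zero, map_zero, mul_zero]
  · intro x x' hx hx'
    rw [mul_add, map_add, map_add, hx, hx', mul_add]
  · intro r x hx
    rw [mul_smul_comm, map_smul, map_smul, hx, mul_smul_comm]
  intro i' j' b' hb' ω' hω'
  rw [cylTmul_mul_cylTmul B b b' hω hb', map_smul, evalAt_cylTmul, evalAt_cylTmul, evalAt_cylTmul,
    map_mul, smul_mul_smul_comm]
  rcases Nat.eq_zero_or_pos j with rfl | hj
  · rw [zero_mul, pow_zero, one_smul]
  · rw [intervalEval_eq_zero s hj hω, zero_mul, zero_smul, smul_zero]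

theorem cylinder_one : (1 : B.cylinder.carrier) = cylTmul 1 1 := rfl

/-- The evaluation `B ⊗ Λ(t, dt) → B` at `t = s` as a map of CDGAs. -/
noncomputable def evalHom (s : ℚ) : Hom B.cylinder B where
  toAlgHom := AlgHom.ofLinearMap (B.evalAt s)
    (by rw [cylinder_one, evalAt_cylTmul, map_one, one_smul]) (B.evalAt_mul s)
  map_deg {n z} hz := by
    refine B.cylinder_deg_induction (P := fun z => B.evalAt s z ∈ B.deg n) ?_ ?_ ?_ ?_ hz
    · rw [map_zero]
      exact zero_mem _
    · intro x y hx hy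
      rw [map_add]
      exact add_mem hx hy
    · intro r x hx
      rw [map_smul]
      exact Submodule.smul_mem _ r hx
    · intro i j hij b hb ω hω
      rw [evalAt_cylTmul]
      rcases Nat.eq_zero_or_pos j with rfl | hj
      · obtain rfl : i = n := hij
        exact Submodule.smul_mem _ _ hb
      · rw [intervalEval_eq_zero s hj hω, zero_smul]
        exact zero_mem _
  map_d z := by
    change B.evalAt s (B.cylinder.d z) = B.d (B.evalAt s z)
    refine B.cylinder_induction
      (P := fun z => B.evalAt s (B.cylinder.d z) = B.d (B.evalAt s z)) ?_ ?_ ?_ ?_ z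
    · simp only [map_zero]
    · intro x y hx hy
      simp only [map_add, hx, hy]
    · intro r x hx
      simp only [map_smul, hx]
    · intro i j b _ ω _
      have h : intervalEval s (intervalD ω) = 0 :=
        intervalEval_eq_zero s one_pos (inr_mem_intervalDeg _)
      rw [cylinder_d_cylTmul, map_add, evalAt_cylTmul, evalAt_cylTmul, evalAt_cylTmul, map_smul,
        h, zero_smul, add_zero]

theorem evalHom_apply (s : ℚ) (z : B.cylinder.carrier) : B.evalHom s z = B.evalAt s z := rfl

theorem fiberIntegral_cylTmul (b : B.carrier) (ω : IntervalCarrier) :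
    B.fiberIntegral (cylTmul b ω) = cylTmul (B.sign b) (intervalIntegral ω) := rfl

/-- `(b, ω) ↦ b ⊗ ω`. -/
noncomputable def cylLin : B.carrier →ₗ[ℚ] IntervalCarrier →ₗ[ℚ] B.cylinder.carrier :=
  (TensorProduct.mk ℚ B.carrier intervalForms.carrier).compr₂
    (GradedTensorProduct.of ℚ B.deg intervalForms.deg).toLinearMap

variable {B} in
theorem cylLin_apply (b : B.carrier) (ω : IntervalCarrier) : B.cylLin b ω = cylTmul b ω := rfl

/-- `d ∫₀ᵗ + ∫₀ᵗ d = id - ε_0`. -/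
theorem d_fiberIntegral (z : B.cylinder.carrier) :
    B.cylinder.d (B.fiberIntegral z) + B.fiberIntegral (B.cylinder.d z) =
      z - cylTmul (B.evalAt 0 z) 1 := by
  rw [← cylLin_apply]
  refine B.cylinder_induction (P := fun z =>
    B.cylinder.d (B.fiberIntegral z) + B.fiberIntegral (B.cylinder.d z) =
      z - B.cylLin (B.evalAt 0 z) 1) ?_ ?_ ?_ ?_ z
  · simp only [map_zero, LinearMap.zero_apply, sub_zero, add_zero]
  · intro x y hx hy
    have := congrArg₂ (· + ·) hx hy
    simp only [map_add, LinearMap.add_apply] at this ⊢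
    rw [add_add_add_comm, this]
    abel
  · intro r x hx
    simp only [map_smul, LinearMap.smul_apply, ← smul_add, ← smul_sub, hx]
  · intro i j b _ ω _
    rw [cylinder_d_cylTmul, map_add, fiberIntegral_cylTmul, fiberIntegral_cylTmul,
      fiberIntegral_cylTmul, cylinder_d_cylTmul, evalAt_cylTmul, B.sign_d, B.sign_sign]
    simp only [← cylLin_apply]
    -- The two terms with `d b` cancel by the anticommutation of sign and differential, leaving the
    -- identity on the interval.
    rw [map_smul, map_neg, LinearMap.smul_apply, LinearMap.neg_apply, add_add_add_comm,
      add_neg_cancel, zero_add, ← map_add, intervalD_intervalIntegral, map_sub, map_smul]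

theorem fiberIntegral_mem {n : ℕ} {z : B.cylinder.carrier} (hz : z ∈ B.cylinder.deg (n + 1)) :
    B.fiberIntegral z ∈ B.cylinder.deg n := by
  refine B.cylinder_deg_induction (P := fun z => B.fiberIntegral z ∈ B.cylinder.deg n)
    ?_ ?_ ?_ ?_ hz
  · rw [map_zero]
    exact zero_mem _
  · intro x y hx hy
    rw [map_add]
    exact add_mem hx hy
  · intro r x hx
    rw [map_smul]
    exact Submodule.smul_mem _ r hx
  · intro i j hij b hb ω hω
    rw [fiberIntegral_cylTmul, ← cylLin_apply]
    rcases mem_intervalDeg_cases hω with ⟨rfl, p, rfl⟩ | ⟨rfl, q, rfl⟩ | rfl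
    · have h : intervalIntegral (TrivSqZeroExt.inl p) = 0 := by
        simp [intervalIntegral, formPart_apply]
      rw [h, map_zero]
      exact zero_mem _
    · obtain rfl : i = n := by omega
      have h := B.cylTmul_mem (B.sign_mem hb) (inl_mem_intervalDeg (antiderivative q))
      rw [add_zero] at h
      exact h
    · rw [map_zero, map_zero]
      exact zero_mem _

theorem evalAt_zero_fiberIntegral (z : B.cylinder.carrier) :
    B.evalAt 0 (B.fiberIntegral z) = 0 := by
  refine B.cylinder_induction (P := fun z => B.evalAt 0 (B.fiberIntegral z) = 0) ?_ ?_ ?_ ?_ z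
  · simp only [map_zero]
  · intro x y hx hy
    rw [map_add, map_add, hx, hy, add_zero]
  · intro r x hx
    rw [map_smul, map_smul, hx, smul_zero]
  · intro i j b _ ω _
    have h : ∀ p : ℚ[X], Polynomial.aeval (0 : ℚ) (antiderivative p) = 0 := by
      intro p
      induction p using Polynomial.induction_on' with
      | add p q hp hq => rw [map_add, map_add, hp, hq, add_zero]
      | monomial n a => simp [antiderivative_monomial, Polynomial.aeval_monomial]
    rw [fiberIntegral_cylTmul, evalAt_cylTmul]
    change Polynomial.aeval (0 : ℚ) (antiderivative ω.snd) • _ = _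
    rw [h, zero_smul]

theorem evalAt_cylTmul_one (s : ℚ) (b : B.carrier) : B.evalAt s (cylTmul b 1) = b := by
  rw [evalAt_cylTmul, map_one, one_smul]

/-- Adding `d (y ⊗ t)` to a homotopy therefore fixes its start and moves its end by `d y`, which is
how the primitive `y` enters the construction. -/
theorem evalAt_d_cylTmul_T (s : ℚ) (y : B.carrier) :
    B.evalAt s (B.cylinder.d (cylTmul y intervalT)) = s • B.d y := by
  have h := (B.evalHom s).map_d (cylTmul y intervalT)
  rw [evalHom_apply, evalHom_apply, evalAt_cylTmul, map_smul] at h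
  rw [h]
  congr 1
  simp [intervalEval, intervalT]

theorem d_cylTmul_one (b : B.carrier) : B.cylinder.d (cylTmul b 1) = cylTmul (B.d b) 1 := by
  have h : intervalD 1 = 0 := intervalForms.d_one
  rw [cylinder_d_cylTmul, h, ← cylLin_apply (B.sign b), map_zero, add_zero]

end Cylinder

/-! ### Cohomology of CDGAs and of cones, elementwise -/

theorem mkQ_cocycles_eq_zero {E : Type u} [AddCommGroup E] [Module ℚ E] {D : Submodule ℚ E}
    {d : E →ₗ[ℚ] E} (x : Cocycles D d) :
    (Submodule.mkQ ((LinearMap.range d).submoduleOf (Cocycles D d)) x : Cohomology D d) = 0 ↔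
      ∃ y, d y = x.1 :=
  Submodule.Quotient.mk_eq_zero _

theorem Hom.mapH_injective_iff {A B : CDGA.{u}} (f : Hom A B) (n : ℕ) :
    Function.Injective (f.mapH n) ↔
      ∀ a ∈ A.deg n, A.d a = 0 → (∃ b, B.d b = f a) → ∃ c, A.d c = a := by
  rw [← LinearMap.ker_eq_bot, LinearMap.ker_eq_bot']
  constructor
  · intro h a ha hd hb
    exact (mkQ_cocycles_eq_zero ⟨a, ha, hd⟩).1 (h _ ((mkQ_cocycles_eq_zero
      ⟨f a, f.map_deg ha, by
        rw [SetLike.mem_coe, LinearMap.mem_ker, ← f.map_d, hd, map_zero]⟩).2 hb))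
  · intro h z hz
    obtain ⟨⟨a, ha, hd⟩, rfl⟩ := Submodule.mkQ_surjective _ z
    exact (mkQ_cocycles_eq_zero ⟨a, ha, hd⟩).2 (h a ha hd ((mkQ_cocycles_eq_zero
      ⟨f a, f.map_deg ha, by
        have hd' : A.d a = 0 := hd
        rw [SetLike.mem_coe, LinearMap.mem_ker, ← f.map_d, hd', map_zero]⟩).1 hz))

theorem Hom.mapH_surjective_iff {A B : CDGA.{u}} (f : Hom A B) (n : ℕ) :
    Function.Surjective (f.mapH n) ↔
      ∀ b ∈ B.deg n, B.d b = 0 → ∃ a ∈ A.deg n, A.d a = 0 ∧ ∃ c, B.d c = f a - b := by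
  constructor
  · intro h b hb hd
    obtain ⟨z, hz⟩ := h (Submodule.mkQ _ ⟨b, hb, hd⟩)
    obtain ⟨⟨a, ha, hd⟩, rfl⟩ := Submodule.mkQ_surjective _ z
    exact ⟨a, ha, hd, (Submodule.Quotient.eq _).1 hz⟩
  · intro h z
    obtain ⟨⟨b, hb, hd⟩, rfl⟩ := Submodule.mkQ_surjective _ z
    obtain ⟨a, ha, hd, hc⟩ := h b hb hd
    exact ⟨Submodule.mkQ _ ⟨a, ha, hd⟩, (Submodule.Quotient.eq _).2 hc⟩

/-- `Cohomology` divides by the whole range of `d`, so a primitive may be inhomogeneous. Its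
component in the correct degree is again a primitive. -/
theorem exists_d_eq (A : CDGA.{u}) {n : ℕ} {a x : A.carrier} (ha : a ∈ A.deg (n + 1))
    (hx : A.d x = a) : ∃ y ∈ A.deg n, A.d y = a :=
  ⟨A.proj n x, A.proj_mem n x, by rw [d_proj, hx, proj_same _ ha]⟩

/-! ### Cones, simple connectivity and the rise in connectivity. -/

section

variable {M A : CDGA.{u}} {m : Hom M A}

theorem exists_coneD_eq {n : ℕ} {p : M.carrier × A.carrier} (hp : p ∈ coneDeg m (n + 1))
    (h : ∃ x, coneD m x = p) :
    ∃ x ∈ M.deg (n + 1), ∃ y ∈ A.deg n, coneD m (x, y) = p := by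
  obtain ⟨⟨x, y⟩, rfl⟩ := h
  refine ⟨_, M.proj_mem (n + 1) x, _, A.proj_mem n y, ?_⟩
  rw [coneD_apply, d_proj, d_proj, m.map_proj, ← map_sub]
  exact Prod.ext (proj_same _ hp.1) (proj_same _ hp.2)

theorem coneZ_d {n : ℕ} (z : coneZ m n) : M.d z.1.1 = 0 ∧ m z.1.1 = A.d z.1.2 := by
  have h : coneD m z.1 = 0 := z.2.2
  exact ⟨congrArg Prod.fst h, sub_eq_zero.1 (congrArg Prod.snd h)⟩

theorem represents_of_mk_eq {n : ℕ} (z : coneZ m n) {α : coneH m n}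
    (hz : Submodule.mkQ _ z = α) {a : M.carrier} {b : A.carrier} (ha : a = z.1.1)
    (hb : b = z.1.2) : Represents m n a b α := by
  subst ha hb
  exact ⟨z.2, hz⟩

/-- What is used of a `k`-minimal model of a simply connected CDGA. -/
theorem Hom.IsMinimalModel.shape (hA : A.SimplyConnected) {k : ℕ} (hk : 1 ≤ k)
    (hm : m.IsMinimalModel k) :
    Function.Injective (algebraMap ℚ M.carrier) ∧
      (∀ x ∈ M.deg 0, ∃ q : ℚ, x = algebraMap ℚ _ q) ∧ (∀ x ∈ M.deg 1, x = 0) ∧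
        ∀ x ∈ M.deg (k + 1), x ∈ M.augIdeal * M.augIdeal := by
  obtain ⟨h0, h1, hQ, -⟩ := hm.1.shape
  refine ⟨?_, h0, ?_, hQ _ k.lt_succ_self⟩
  · have hA0 := hA.1 0 (zero_mem _) (map_zero _)
    rw [injective_iff_map_eq_zero]
    intro q hq
    refine hA0.unique ?_ (map_zero _)
    rw [← m.toAlgHom.commutes, hq, map_zero]
  · intro x hx
    -- Elements of `M^1` are cocycles, `m x` is exact because `H^1(A) = 0`, and `m` is injective on
    -- `H^1`. So `x` is the differential of an element of `M^0`, that is, of a scalar.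
    have hd := h1 x hx
    obtain ⟨y, hy⟩ := (m.mapH_injective_iff 1).1 (hm.2.1 1 (by omega)).1 x hx hd
      ((mkQ_cocycles_eq_zero ⟨m x, m.map_deg hx, by
        rw [SetLike.mem_coe, LinearMap.mem_ker, ← m.map_d, hd, map_zero]⟩).1
          (@Subsingleton.elim _ hA.2 _ _))
    obtain ⟨z, hz, rfl⟩ := M.exists_d_eq hx hy
    obtain ⟨q, rfl⟩ := h0 z hz
    rw [Algebra.algebraMap_eq_smul_one, map_smul, d_one, smul_zero]

/-- Adjoining generators for the cohomology of the cone raises the connectivity. -/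
theorem isConnected_of_section {j : ℕ} (hj : 1 ≤ j) (hm : m.IsConnected (j + 1))
    (h0 : ∀ x ∈ M.deg 0, ∃ q : ℚ, x = algebraMap ℚ _ q) (h1 : ∀ x ∈ M.deg 1, x = 0)
    {δ : coneH m (j + 1) →ₗ[ℚ] M.carrier} (hδ : ∀ v, δ v ∈ M.deg (j + 1 + 1))
    (hd : ∀ v, M.d (δ v) = 0) (m' : Hom (hirsch M (j + 1) δ hδ hd) A)
    (hl : ∀ x, m' (hirschIncl hδ hd x) = m x)
    (hr : ∀ α, Represents m (j + 1) (δ α) (m' (hirschGen hδ hd α)) α) :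
    m'.IsConnected (j + 1 + 1) := by
  have hdg : ∀ α, (hirsch M (j + 1) δ hδ hd).d (hirschGen hδ hd α) = hirschIncl hδ hd (δ α) :=
    Hirsch.diff_gen _ hδ
  have hdl : ∀ a, (hirsch M (j + 1) δ hδ hd).d (hirschIncl hδ hd a) = hirschIncl hδ hd (M.d a) :=
    fun a => ((hirschIncl hδ hd).map_d a).symm
  have hi := hirschIncl_injective hδ hd
  have cases := fun {n x} => hirsch_deg_cases hδ hd j.succ_pos h0 (n := n) (x := x)
  -- Any cocycle in the class `α` differs from the chosen representative by a coboundary with a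
  -- homogeneous primitive. It is applied below to `(0, b)` and to `(a, b)`.
  have lift : ∀ α, ∀ z b, (z, b) ∈ coneZ m (j + 1) → Represents m (j + 1) z b α →
      ∃ x ∈ M.deg (j + 1), ∃ y ∈ A.deg j,
        coneD m (x, y) = (δ α - z, m' (hirschGen hδ hd α) - b) := by
    rintro α z b hz ⟨hz', e⟩
    obtain ⟨hα, e'⟩ := hr α
    have h := (Submodule.Quotient.eq _).1 (e'.trans e.symm)
    exact exists_coneD_eq (sub_mem hα.1 hz.1) h
  refine ⟨fun i hi' => ⟨?_, ?_⟩, ?_⟩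
  · rw [m'.mapH_injective_iff]
    intro x hx hdx hb
    rcases Nat.lt_succ_iff_lt_or_eq.1 hi' with hlt | rfl
    · obtain ⟨a, ha, rfl⟩ := (cases hx).1 hlt
      rw [hdl, ← map_zero (hirschIncl hδ hd).toAlgHom] at hdx
      rw [hl] at hb
      obtain ⟨c, rfl⟩ := (m.mapH_injective_iff i).1 (hm.1 i hlt).1 a ha (hi hdx) hb
      exact ⟨hirschIncl hδ hd c, hdl c⟩
    · obtain ⟨a, ha, α, rfl⟩ := (cases hx).2.1 rfl
      rw [map_add, hdl, hdg, ← map_add, ← map_zero (hirschIncl hδ hd).toAlgHom] at hdx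
      have hdx := hi hdx
      rw [map_add, hl] at hb
      obtain ⟨b, hb⟩ := hb
      obtain ⟨hα, e⟩ := hr α
      -- If `a + α` is closed with `m' (a + α) = d b`, then `(-a, -b)` is a primitive in the cone of
      -- the representative of `α`. So no new class can die, and injectivity of `m` handles `a`.
      have hα0 : α = 0 := by
        rw [← e]
        refine (mkQ_cocycles_eq_zero ⟨_, hα⟩).2 ⟨(-a, -b), ?_⟩
        rw [coneD_apply, map_neg, map_neg, map_neg, hb]
        exact Prod.ext (neg_eq_of_add_eq_zero_right hdx) (by
          change -m a - -(m a + m' (hirschGen hδ hd α)) = m' (hirschGen hδ hd α)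
          abel)
      subst hα0
      rw [map_zero, map_zero, add_zero] at hb
      rw [map_zero, add_zero] at hdx
      obtain ⟨c, rfl⟩ := (m.mapH_injective_iff _).1 hm.2 a ha hdx ⟨b, hb⟩
      exact ⟨hirschIncl hδ hd c, by rw [hdl, map_zero, add_zero]⟩
  · rw [m'.mapH_surjective_iff]
    intro b hb hdb
    rcases Nat.lt_succ_iff_lt_or_eq.1 hi' with hlt | rfl
    · obtain ⟨a, ha, hda, hc⟩ := (m.mapH_surjective_iff i).1 (hm.1 i hlt).2 b hb hdb
      exact ⟨hirschIncl hδ hd a, (hirschIncl hδ hd).map_deg ha, by rw [hdl, hda, map_zero],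
        by rwa [hl]⟩
    -- A cocycle `b` of `A` gives the cone cocycle `(0, b)`. With `α` its class, `δ α = d x` for
    -- some `x` in `M`, and the closed element `α - x` maps to `b` up to the coboundary `-d y`.
    · have hz : ((0 : M.carrier), b) ∈ coneZ m (j + 1) := by
        refine ⟨⟨zero_mem _, hb⟩, ?_⟩
        rw [SetLike.mem_coe, LinearMap.mem_ker, coneD_apply, hdb, map_zero, map_zero, sub_zero]
        rfl
      obtain ⟨x, hx, y, -, hxy⟩ := lift (Submodule.mkQ _ ⟨_, hz⟩) 0 b hz ⟨hz, rfl⟩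
      set α : coneH m (j + 1) := Submodule.mkQ _ ⟨_, hz⟩
      rw [coneD_apply, Prod.mk.injEq, sub_zero] at hxy
      refine ⟨hirschGen hδ hd α - hirschIncl hδ hd x,
        sub_mem (Hirsch.gen_mem M _ α) ((hirschIncl hδ hd).map_deg hx), ?_, -y, ?_⟩
      · rw [map_sub, hdl, hdg, hxy.1, sub_self]
      · rw [map_sub, hl, map_neg, ← sub_eq_zero, sub_right_comm _ (m x) b, ← hxy.2]
        abel
  · rw [m'.mapH_injective_iff]
    rintro x hx hdx ⟨b, hb⟩
    -- One degree above the generators everything comes from `M`, since `M^1 = 0`. If `m a = d b`,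
    -- the class `α` of `(a, b)` provides a generator, and correcting it by `x` gives a primitive of
    -- `a`.
    obtain ⟨a, ha, rfl⟩ := (cases hx).2.2 (by omega) h1 rfl
    rw [hdl, ← map_zero (hirschIncl hδ hd).toAlgHom] at hdx
    rw [hl] at hb
    obtain ⟨b, hbd, hb⟩ := A.exists_d_eq (m.map_deg ha) hb
    have hz : (a, b) ∈ coneZ m (j + 1) := by
      refine ⟨⟨ha, hbd⟩, ?_⟩
      rw [SetLike.mem_coe, LinearMap.mem_ker, coneD_apply, hi hdx, hb, sub_self]
      rfl
    obtain ⟨x, hx, y, -, hxy⟩ := lift (Submodule.mkQ _ ⟨_, hz⟩) a b hz ⟨hz, rfl⟩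
    set α : coneH m (j + 1) := Submodule.mkQ _ ⟨_, hz⟩
    rw [coneD_apply, Prod.mk.injEq] at hxy
    refine ⟨hirschGen hδ hd α - hirschIncl hδ hd x, ?_⟩
    rw [map_sub, hdl, hdg, hxy.1, ← map_sub, sub_sub_cancel]

end

/-! ### Linear choices of sections and primitives. -/

section LinearAlgebra

variable {V W Y Z : Type u} [AddCommGroup V] [Module ℚ V] [AddCommGroup W] [Module ℚ W]
  [AddCommGroup Y] [Module ℚ Y] [AddCommGroup Z] [Module ℚ Z]

/-- A section `t` of `q : Z → W` that is prescribed on the image of a complement of `ker ψ`. -/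
theorem exists_section_extending (ψ : V →ₗ[ℚ] W) (U : Submodule ℚ V)
    (hU : Disjoint U (LinearMap.ker ψ)) (q : Z →ₗ[ℚ] W) (hq : Function.Surjective q)
    (s : V →ₗ[ℚ] Z) (hs : ∀ v, q (s v) = ψ v) :
    ∃ t : W →ₗ[ℚ] Z, (∀ w, q (t w) = w) ∧ ∀ ε ∈ U, t (ψ ε) = s ε := by
  obtain ⟨t, ht⟩ := q.exists_rightInverse_of_surjective (LinearMap.range_eq_top.2 hq)
  obtain ⟨r, hr⟩ := (ψ ∘ₗ U.subtype).exists_leftInverse_of_injective (by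
    rw [LinearMap.ker_eq_bot']
    intro ε hε
    exact Subtype.ext (Submodule.disjoint_def.1 hU ε ε.2 hε))
  have ht' : ∀ w, q (t w) = w := fun w => LinearMap.congr_fun ht w
  have hr' : ∀ ε : U, r (ψ ε) = ε := fun ε => LinearMap.congr_fun hr ε
  -- Here `r` is a left inverse of `ψ` on `U`. The correction lies in `ker q` because `q s = ψ`, and
  -- on `ψ ε` it replaces `t (ψ ε)` by `s ε`.
  refine ⟨t + (s - t ∘ₗ ψ) ∘ₗ U.subtype ∘ₗ r, fun w => ?_, fun ε hε => ?_⟩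
  · simp [hs, ht']
  · have := hr' ⟨ε, hε⟩
    simp [this]

/-- A linear choice of preimages, in a submodule, of elements of the image. -/
theorem exists_linear_lift (D : Y →ₗ[ℚ] Z) (P : Submodule ℚ Y) (K : Submodule ℚ V)
    (h : V →ₗ[ℚ] Z) (hK : ∀ v ∈ K, ∃ y ∈ P, D y = h v) :
    ∃ l : K →ₗ[ℚ] Y, ∀ v, l v ∈ P ∧ D (l v) = h v := by
  let h' : K →ₗ[ℚ] LinearMap.range (D ∘ₗ P.subtype) :=
    (h ∘ₗ K.subtype).codRestrict _ fun v => by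
      obtain ⟨y, hy, e⟩ := hK v v.2
      exact ⟨⟨y, hy⟩, e⟩
  obtain ⟨l, hl⟩ := Module.projective_lifting_property (D ∘ₗ P.subtype).rangeRestrict h'
    (LinearMap.surjective_rangeRestrict _)
  exact ⟨P.subtype ∘ₗ l, fun v =>
    ⟨(l v).2, congrArg Subtype.val (LinearMap.congr_fun hl v)⟩⟩

end LinearAlgebra

/-! ### The inductive step for minimal models of maps. -/

namespace MinimalModelOfMap

variable {A B : CDGA.{u}} {f : Hom A B}

/-- Everything is built from the sections `s`, `t` and the primitives `p`; the pushout property of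
the two Hirsch extensions turns these linear maps into maps of CDGAs. Writing the degree as `j + 1`
avoids subtraction. -/
theorem exists_extension (hA : A.SimplyConnected) (hB : B.SimplyConnected) {j : ℕ} (hj : 1 ≤ j)
    (S : MinimalModelOfMap f j) :
    ∃ (T : MinimalModelOfMap f (j + 1))
      (E : HirschExtension (j + 1) (coneH S.m (j + 1)) S.M T.M)
      (F : HirschExtension (j + 1) (coneH S.n (j + 1)) S.N T.N),
      (∀ x, T.g (E.incl x) = F.incl (S.g x)) ∧
      (∀ x, T.m (E.incl x) = S.m x) ∧
      (∀ y, T.n (F.incl y) = S.n y) ∧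
      (∀ x, T.H.toHom (E.incl x) = S.H.toHom x) ∧
      (∀ α, Represents S.m (j + 1) (E.attach α) (T.m (E.gen α)) α) ∧
      (∀ β, Represents S.n (j + 1) (F.attach β) (T.n (F.gen β)) β) ∧
      Function.Bijective E.toQ ∧ Function.Bijective F.toQ ∧
      (∀ α, T.g.mapQ (j + 1) (E.toQ α) = F.toQ (S.mapConeH (j + 1) α)) ∧
      ∃ U : Submodule ℚ (coneH S.m (j + 1)), IsCompl U (LinearMap.ker (S.mapConeH (j + 1))) ∧
        (∀ ε ∈ U,
          (F.attach (S.mapConeH (j + 1) ε), T.n (F.gen (S.mapConeH (j + 1) ε))) =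
            S.coneMap (E.attach ε, T.m (E.gen ε)) ∧
          T.g (E.gen ε) = F.gen (S.mapConeH (j + 1) ε) ∧
          T.H.toHom (E.gen ε) = cylTmul (f (T.m (E.gen ε))) 1 + S.intHt (E.attach ε)) ∧
        ∀ α ∈ LinearMap.ker (S.mapConeH (j + 1)), ∃ x ∈ S.N.deg (j + 1), ∃ y ∈ B.deg j,
          coneD S.n (x, y) = S.coneMap (E.attach α, T.m (E.gen α)) ∧
          T.g (E.gen α) = F.incl x ∧
          T.H.toHom (E.gen α) =
            cylTmul (f (T.m (E.gen α))) 1 + S.intHt (E.attach α) +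
              B.cylinder.d (cylTmul y intervalT) := by
  obtain ⟨Minj, M0, M1, MQ⟩ := S.m_minimal.shape hA hj
  obtain ⟨Ninj, N0, N1, NQ⟩ := S.n_minimal.shape hB hj
  let ψ := S.mapConeH (j + 1)
  obtain ⟨U, hU⟩ := (LinearMap.ker ψ).exists_isCompl
  -- representatives of the classes in the cones
  obtain ⟨s, hs⟩ := (Submodule.mkQ ((LinearMap.range (coneD S.m)).submoduleOf
    (coneZ S.m (j + 1)))).exists_rightInverse_of_surjective (Submodule.range_mkQ _)
  have hs : ∀ α, Submodule.mkQ _ (s α) = α := fun α => LinearMap.congr_fun hs α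
  let Φ : coneZ S.m (j + 1) →ₗ[ℚ] coneZ S.n (j + 1) :=
    S.coneMap.restrict fun x hx => ⟨S.coneMap_mem x hx.1, by
      have h : coneD S.m x = 0 := hx.2
      change coneD S.n (S.coneMap x) = 0
      rw [← S.coneMap_d, h, map_zero]⟩
  have hΦ : ∀ α, Submodule.mkQ _ (Φ (s α)) = ψ α := fun α => congrArg ψ (hs α)
  -- Representatives in `C_n` are not chosen freely: on `ψ U` they must be the images under `φ` of
  -- those in `C_m`.
  obtain ⟨t, ht, htU⟩ := exists_section_extending ψ U hU.disjoint.symm (Submodule.mkQ _)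
    (Submodule.mkQ_surjective _) (Φ ∘ₗ s) hΦ
  -- primitives of the images of the elements of the kernel
  obtain ⟨l, hl⟩ := exists_linear_lift (coneD S.n) ((S.N.deg (j + 1)).prod (B.deg j))
    (LinearMap.ker ψ) (S.coneMap ∘ₗ (coneZ S.m (j + 1)).subtype ∘ₗ s) (by
      intro α hα
      have h := (mkQ_cocycles_eq_zero (Φ (s α))).1 ((hΦ α).trans hα)
      obtain ⟨x, hx, y, hy, e⟩ := exists_coneD_eq (Φ (s α)).2.1 h
      exact ⟨(x, y), ⟨hx, hy⟩, e⟩)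
  -- Primitives on `ker ψ`, extended by zero on `U`, so that the two kinds of generators are treated
  -- by the same formulas.
  let p : coneH S.m (j + 1) →ₗ[ℚ] S.N.carrier × B.carrier :=
    l ∘ₗ Submodule.projectionOnto _ _ hU
  have pker : ∀ α ∈ LinearMap.ker ψ, coneD S.n (p α) = S.coneMap (s α).1 := by
    intro α hα
    have e : p α = l ⟨α, hα⟩ := congrArg l (Submodule.projectionOnto_apply_left hU ⟨α, hα⟩)
    rw [e]
    exact (hl _).2
  have pU : ∀ ε ∈ U, p ε = 0 := by
    intro ε hε
    have e : p ε = l 0 := congrArg l (Submodule.projectionOnto_apply_right hU ⟨ε, hε⟩)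
    rw [e, map_zero]
  have pdeg : ∀ v, (p v).1 ∈ S.N.deg (j + 1) ∧ (p v).2 ∈ B.deg j := fun v => (hl _).1
  -- The identity `t ψ + d p = φ s`: on `U` the second term vanishes, on `ker ψ` the first. Its two
  -- components govern the map `g'` and the end of the homotopy `H'`.
  have key : ∀ v, (t (ψ v)).1 + coneD S.n (p v) = S.coneMap (s v).1 := by
    intro v
    obtain ⟨α, hα, ε, hε, rfl⟩ :=
      Submodule.mem_sup.1 (hU.sup_eq_top.symm ▸ Submodule.mem_top (x := v))
    have hα' : ψ α = 0 := hα
    have e1 : (t (ψ ε)).1 = S.coneMap (s ε).1 := congrArg Subtype.val (htU ε hε)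
    rw [map_add ψ, hα', zero_add, e1, map_add p, pU ε hε, add_zero, pker α hα, map_add s,
      Submodule.coe_add, map_add, add_comm]
  have key1 : ∀ v, (t (ψ v)).1.1 + S.N.d (p v).1 = S.g (s v).1.1 :=
    fun v => congrArg Prod.fst (key v)
  have key2 : ∀ v, (t (ψ v)).1.2 + (S.n (p v).1 - B.d (p v).2) =
      f (s v).1.2 + S.intH (s v).1.1 := fun v => congrArg Prod.snd (key v)
  -- the two Hirsch extensions
  let δ : coneH S.m (j + 1) →ₗ[ℚ] S.M.carrier :=
    LinearMap.fst ℚ _ _ ∘ₗ (coneZ S.m (j + 1)).subtype ∘ₗ s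
  have hδ : ∀ v, δ v ∈ S.M.deg (j + 1 + 1) := fun v => (s v).2.1.1
  have hδd : ∀ v, S.M.d (δ v) = 0 := fun v => (coneZ_d (s v)).1
  let δ' : coneH S.n (j + 1) →ₗ[ℚ] S.N.carrier :=
    LinearMap.fst ℚ _ _ ∘ₗ (coneZ S.n (j + 1)).subtype ∘ₗ t
  have hδ' : ∀ v, δ' v ∈ S.N.deg (j + 1 + 1) := fun v => (t v).2.1.1
  have hδd' : ∀ v, S.N.d (δ' v) = 0 := fun v => (coneZ_d (t v)).1
  let E := hirschExtension hδ hδd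
  let F := hirschExtension hδ' hδd'
  obtain ⟨m', ⟨ml, mg⟩, -⟩ := E.isPushout A S.m
    (LinearMap.snd ℚ _ _ ∘ₗ (coneZ S.m (j + 1)).subtype ∘ₗ s) (fun v => (s v).2.1.2)
    (fun v => (coneZ_d (s v)).2.symm)
  obtain ⟨n', ⟨nl, ng⟩, -⟩ := F.isPushout B S.n
    (LinearMap.snd ℚ _ _ ∘ₗ (coneZ S.n (j + 1)).subtype ∘ₗ t) (fun v => (t v).2.1.2)
    (fun v => (coneZ_d (t v)).2.symm)
  have mg : ∀ v, m' (E.gen v) = (s v).1.2 := mg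
  have ng : ∀ v, n' (F.gen v) = (t v).1.2 := ng
  obtain ⟨g', ⟨gl, gg⟩, -⟩ := E.isPushout _ (F.incl.comp S.g)
    (F.gen ∘ₗ ψ + F.incl.toAlgHom.toLinearMap ∘ₗ LinearMap.fst ℚ _ _ ∘ₗ p)
    (fun v => add_mem (F.gen_mem _) (F.incl.map_deg (pdeg v).1))
    (fun v => by
      change (hirsch S.N (j + 1) δ' hδ' hδd').d (F.gen (ψ v) + F.incl (p v).1) =
        F.incl (S.g (s v).1.1)
      rw [map_add, F.d_gen, ← F.incl.map_d, ← map_add]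
      exact congrArg _ (key1 v))
  have gl : ∀ x, g' (E.incl x) = F.incl (S.g x) := gl
  have gg : ∀ v, g' (E.gen v) = F.gen (ψ v) + F.incl (p v).1 := gg
  obtain ⟨H', ⟨Hl, Hg⟩, -⟩ := E.isPushout B.cylinder S.H.toHom
    (B.cylLin.flip 1 ∘ₗ f.toAlgHom.toLinearMap ∘ₗ LinearMap.snd ℚ _ _ ∘ₗ
        (coneZ S.m (j + 1)).subtype ∘ₗ s + S.intHt ∘ₗ δ +
      B.cylinder.d ∘ₗ B.cylLin.flip intervalT ∘ₗ LinearMap.snd ℚ _ _ ∘ₗ p)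
    (fun v => by
      change cylTmul (f (s v).1.2) 1 + B.fiberIntegral (S.H.toHom (δ v)) +
        B.cylinder.d (cylTmul (p v).2 intervalT) ∈ B.cylinder.deg (j + 1)
      refine add_mem (add_mem ?_ ?_) (B.cylinder.d_mem ?_)
      · have h := B.cylTmul_mem (f.map_deg (s v).2.1.2) (inl_mem_intervalDeg 1)
        rwa [add_zero] at h
      · exact B.fiberIntegral_mem (S.H.toHom.map_deg (hδ v))
      · have h := B.cylTmul_mem (pdeg v).2 (inl_mem_intervalDeg Polynomial.X)
        rwa [add_zero] at h)
    (fun v => by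
      change B.cylinder.d (cylTmul (f (s v).1.2) 1 + B.fiberIntegral (S.H.toHom (δ v)) +
        B.cylinder.d (cylTmul (p v).2 intervalT)) = S.H.toHom (δ v)
      -- Since `d (δ v) = 0`, the integral has differential `H (δ v) - f (m (δ v)) ⊗ 1`. The
      -- subtracted term is the differential of `f b ⊗ 1`, where `b` is the second entry of `s v`.
      have h := B.d_fiberIntegral (S.H.toHom (δ v))
      rw [← S.H.toHom.map_d, hδd, map_zero, map_zero, add_zero, S.H.eval_zero] at h
      rw [map_add, map_add, B.cylinder.d_d, add_zero, d_cylTmul_one, h, ← f.map_d,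
        ← (coneZ_d (s v)).2]
      exact add_sub_cancel _ _)
  have Hl : ∀ x, H' (E.incl x) = S.H.toHom x := Hl
  have Hg : ∀ v, H' (E.gen v) = cylTmul (f (s v).1.2) 1 + S.intHt (δ v) +
      B.cylinder.d (cylTmul (p v).2 intervalT) := Hg
  have H0 : (B.evalHom 0).comp H' = f.comp m' := by
    refine E.hom_ext (fun x => ?_) (fun v => ?_)
    · change B.evalAt 0 (H' (E.incl x)) = f (m' (E.incl x))
      rw [Hl, S.H.eval_zero, ml]
      rfl
    · change B.evalAt 0 (H' (E.gen v)) = f (m' (E.gen v))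
      rw [Hg, mg, map_add, map_add, evalAt_d_cylTmul_T, zero_smul, add_zero, evalAt_cylTmul_one]
      exact add_eq_left.2 (B.evalAt_zero_fiberIntegral _)
  have H1 : (B.evalHom 1).comp H' = n'.comp g' := by
    refine E.hom_ext (fun x => ?_) (fun v => ?_)
    · change B.evalAt 1 (H' (E.incl x)) = n' (g' (E.incl x))
      rw [Hl, S.H.eval_one, gl, nl]
      rfl
    · change B.evalAt 1 (H' (E.gen v)) = n' (g' (E.gen v))
      rw [Hg, gg, map_add n'.toAlgHom, ng, nl, map_add, map_add, evalAt_d_cylTmul_T, one_smul,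
        evalAt_cylTmul_one]
      change f (s v).1.2 + S.intH (s v).1.1 + B.d (p v).2 = _
      -- At `t = 1` the value is `f b + ∫₀¹ H (δ v) + d y`, and the second component of `key` turns
      -- this into `n'` of `ψ v + x`.
      rw [← key2]
      abel
  have hr : ∀ α, Represents S.m (j + 1) (E.attach α) (m' (E.gen α)) α :=
    fun α => represents_of_mk_eq (s α) (hs α) rfl (mg α)
  have hr' : ∀ α, Represents S.n (j + 1) (F.attach α) (n' (F.gen α)) α :=
    fun α => represents_of_mk_eq (t α) (ht α) rfl (ng α)
  let T : MinimalModelOfMap f (j + 1) :=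
    { M := hirsch S.M (j + 1) δ hδ hδd
      N := hirsch S.N (j + 1) δ' hδ' hδd'
      g := g'
      m := m'
      n := n'
      H := ⟨H', fun a => congrArg (fun h : Hom _ B => h a) H0,
        fun a => congrArg (fun h : Hom _ B => h a) H1⟩
      m_minimal := ⟨.step E S.m_minimal.1,
        isConnected_of_section hj S.m_minimal.2 M0 M1 hδ hδd m' ml hr⟩
      n_minimal := ⟨.step F S.n_minimal.1,
        isConnected_of_section hj S.n_minimal.2 N0 N1 hδ' hδd' n' nl hr'⟩ }
  refine ⟨T, E, F, gl, ml, nl, Hl, hr, hr',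
    hirschExtension_toQ_bijective hδ hδd j.succ_pos Minj M0 MQ,
    hirschExtension_toQ_bijective hδ' hδd' j.succ_pos Ninj N0 NQ, ?_, U, hU.symm, ?_, ?_⟩
  · intro α
    refine (Submodule.Quotient.eq _).2 ?_
    change g' (E.gen α) - F.gen (ψ α) ∈ T.N.augIdeal * T.N.augIdeal
    rw [gg, add_sub_cancel_left]
    -- The correction `x` has degree `j + 1`, above all generators of the `j`-minimal algebra `N`,
    -- so it is decomposable.
    exact F.incl.map_decomposable (NQ _ (pdeg α).1)
  · intro ε hε
    refine ⟨?_, ?_, ?_⟩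
    · have h := key ε
      rw [pU ε hε, map_zero, add_zero] at h
      change ((t (ψ ε)).1.1, n' (F.gen (ψ ε))) = S.coneMap ((s ε).1.1, m' (E.gen ε))
      rw [ng, mg]
      exact h
    · change g' (E.gen ε) = F.gen (ψ ε)
      rw [gg, pU ε hε, Prod.fst_zero, map_zero, add_zero]
    · change H' (E.gen ε) = cylTmul (f (m' (E.gen ε))) 1 + S.intHt (δ ε)
      rw [Hg, mg, pU ε hε, Prod.snd_zero, ← cylLin_apply 0, map_zero, LinearMap.zero_apply,
        map_zero, add_zero]
  · intro α hα
    have hα' : ψ α = 0 := hα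
    refine ⟨(p α).1, (pdeg α).1, (p α).2, (pdeg α).2, ?_, ?_, ?_⟩
    · change coneD S.n (p α) = S.coneMap ((s α).1.1, m' (E.gen α))
      rw [mg]
      exact pker α hα
    · change g' (E.gen α) = F.incl (p α).1
      rw [gg, hα', map_zero, zero_add]
    · change H' (E.gen α) = cylTmul (f (m' (E.gen α))) 1 + S.intHt (δ α) + _
      rw [Hg, mg]

end MinimalModelOfMap

end CDGA

theorem mainTheorem3 {A B : CDGA.{u}} (hA : A.SimplyConnected) (hB : B.SimplyConnected)
    (f : CDGA.Hom A B) (k : ℕ) (hk : 2 ≤ k) (S : CDGA.MinimalModelOfMap f (k - 1)) :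
    ∃ (T : CDGA.MinimalModelOfMap f k)
      (E : CDGA.HirschExtension k (CDGA.coneH S.m k) S.M T.M)
      (F : CDGA.HirschExtension k (CDGA.coneH S.n k) S.N T.N),
      -- `T` extends `S`
      (∀ x, T.g (E.incl x) = F.incl (S.g x)) ∧
      (∀ x, T.m (E.incl x) = S.m x) ∧
      (∀ y, T.n (F.incl y) = S.n y) ∧
      (∀ x, T.H.toHom (E.incl x) = S.H.toHom x) ∧
      -- the generators are attached along representatives of the classes in the cones
      (∀ α, CDGA.Represents S.m k (E.attach α) (T.m (E.gen α)) α) ∧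
      (∀ β, CDGA.Represents S.n k (F.attach β) (T.n (F.gen β)) β) ∧
      -- `Q^k(T.g) = H^k(φ)`
      Function.Bijective E.toQ ∧ Function.Bijective F.toQ ∧
      (∀ α, T.g.mapQ k (E.toQ α) = F.toQ (S.mapConeH k α)) ∧
      -- explicit formulas, on a complement of the kernel of `H^k(φ)` and on the kernel
      ∃ U : Submodule ℚ (CDGA.coneH S.m k), IsCompl U (LinearMap.ker (S.mapConeH k)) ∧
        (∀ ε ∈ U,
          (F.attach (S.mapConeH k ε), T.n (F.gen (S.mapConeH k ε))) =
            S.coneMap (E.attach ε, T.m (E.gen ε)) ∧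
          T.g (E.gen ε) = F.gen (S.mapConeH k ε) ∧
          T.H.toHom (E.gen ε) =
            CDGA.cylTmul (f (T.m (E.gen ε))) 1 + S.intHt (E.attach ε)) ∧
        ∀ α ∈ LinearMap.ker (S.mapConeH k), ∃ x ∈ S.N.deg k, ∃ y ∈ B.deg (k - 1),
          CDGA.coneD S.n (x, y) = S.coneMap (E.attach α, T.m (E.gen α)) ∧
          T.g (E.gen α) = F.incl x ∧
          T.H.toHom (E.gen α) =
            CDGA.cylTmul (f (T.m (E.gen α))) 1 + S.intHt (E.attach α) +
              B.cylinder.d (CDGA.cylTmul y CDGA.intervalT) := by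
  -- After this substitution `k - 1` reduces to `j` by definition, so the two statements match
  -- without a cast.
  obtain ⟨j, rfl⟩ : ∃ j, k = j + 1 := ⟨k - 1, by omega⟩
  exact S.exists_extension hA hB (by omega)
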